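/- Let $0\le T<\infty$ and consider a plant $\dot x(t)=f(x(t),u(t),t)$, $y(t)=g(x(t),u(t),t)$, $t\in[0,T]$, with state in $\mathbb R^n$, input in $\mathbb R^m$ and output in $\mathbb R^p$. Let $y_{\mathrm{des}}$ be an achievable output: there are a continuously differentiable input $u^*$ and a state trajectory $x^*$ on $[0,T]$ with $\dot x^*=f(x^*,u^*,t)$ and $y_{\mathrm{des}}=g(x^*,u^*,t)$. Assume that $f$ and $g$ are continuously differentiable on a neighbourhood, relative to $\mathbb R^n\times\mathbb R^m\times[0,T]$, of the graph $\{(x^*(t),u^*(t),t):t\in[0,T]\}$. Let $l:\mathbb R^p\times[0,T]\to\mathbb R^m$ be continuously differentiable with $l(0,t)=0$ for all $t$. Consider the iterative learning control scheme $$\dot x_k=f(x_k,u_k,t),\quad y_k=g(x_k,u_k,t),\quad u_{k+1}=u_k+l(e_k,t),\quad e_k=y_k-y_{\mathrm{des}}\qquad(k\in\mathbb N),$$ with continuously differentiable $u_k,y_k$, and put $D(t)=\frac{\partial g}{\partial u}(x^*(t),u^*(t),t)$ and $L(t)=\frac{\partial l}{\partial\theta}(0,t)$. In the variables $\underline x_k=x_k-x^*$,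 $\underline u_k=u_k-u^*$, $w_k=(e_k,\underline u_k)$, the passes $k\ge 1$ of the scheme are exactly the repetitive process $$\dot{\underline x}_{k+1}=\underline f(\underline x_{k+1},w_k,t),\qquad w_{k+1}=\big(\underline g(\underline x_{k+1},w_k,t),\ \underline u_k+l(e_k,t)\big),\qquad(1)$$ where, for $w=(\theta,v)$, $\underline f(\chi,w,t)=f(\chi+x^*(t),v+u^*(t)+l(\theta,t),t)-\dot x^*(t)$ and $\underline g(\chi,w,t)=g(\chi+x^*(t),v+u^*(t)+l(\theta,t),t)-y_{\mathrm{des}}(t)$; that is, sequences $(x_k,u_k,y_k)$ form a run of the scheme if and only if pass $0$ satisfies the plant equations and $(\underline x_k,w_k)$ is a trajectory of (1). Moreover $$\sup_{t\in[0,T]}\rho\left(\begin{bmatrix}D(t)\\ I\end{bmatrix}\begin{bmatrix}L(t)&I\end{bmatrix}\right)=\sup_{t\in[0,T]}\rho(I+L(t)D(t)),$$ and if $p=m$ this also equals $\sup_{t\in[0,T]}\rho(I+D(t)L(t))$ ($\rho$ is the spectral radius over $\mathbb C$; these suprema are maxima). If $$\max_{t\in[0,T]}\rho(I+L(t)D(t))<1,$$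 then (1) is (locally) exponentially stable in the following sense. The boundary data are an arbitrary continuously differentiable pair $w_0$ on $[0,T]$ and an arbitrary sequence $\xi=(\underline x_{k+1}(0))_{k\ge0}$ of initial states; write $\|w\|_\infty=\sup_{[0,T]}\|w(t)\|$ and $\|\xi\|_{e_\lambda}=\sup_k\lambda^{-k}\|\underline x_{k+1}(0)\|$ for $\lambda\in(0,1]$. 1. (Lyapunov stability) For every $\epsilon>0$ there is $\delta_1\in(0,\epsilon)$ such that, if $\|w_0\|_\infty+\|\xi\|_{e_1}<\delta_1$, then (1) has a unique solution for all $k$, and $\|w_k\|_\infty<\epsilon$ for all $k$. 2. (Asymptotic stability) There is $\delta_2>0$ such that, if $\|w_0\|_\infty+\|\xi\|_{e_1}<\delta_2$ and $\underline x_{k+1}(0)\to0$, then (1) has a unique solution for all $k$, and $\|w_k\|_\infty\to0$. 3. (Exponential estimate) There are $\delta_3>0$ and continuous strictly increasing functions $K:(0,1)\to[1,\infty)$ and $\gamma:(0,1)\to(0,1)$ such that, for every $\lambda\in(0,1)$, if $\|w_0\|_\infty+\|\xi\|_{e_\lambda}<\delta_3$, then (1) has a unique solution for all $k$, and $\|w_k\|_\infty\le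 K(\lambda)\gamma(\lambda)^k(\|w_0\|_\infty+\|\xi\|_{e_\lambda})$ for all $k$. -/

import Mathlib

open Set Filter Topology
open scoped ENNReal

/-- The uniform (`L_∞`) norm on the pass `[0, T]`, as an extended nonnegative real. -/
noncomputable def passNorm {F : Type*} [NormedAddCommGroup F] (T : ℝ) (w : ℝ → F) : ℝ≥0∞ :=
  ⨆ t ∈ Icc (0 : ℝ) T, ‖w t‖ₑ

/-- The exponential norm `sup_k r^(-k) ‖b_{k+1}‖` of a sequence; here `b k` stands for `b_{k+1}`.
For `r = 1` it is the usual supremum norm of the sequence. -/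
noncomputable def expNorm {E : Type*} [NormedAddCommGroup E] (r : ℝ) (b : ℕ → E) : ℝ≥0∞ :=
  ⨆ k : ℕ, ENNReal.ofReal (r⁻¹ ^ k) * ‖b k‖ₑ

/-- The data of a differential repetitive process on `[0, T]`:
`x_{k+1}'(t) = f (x_{k+1}(t), y_k(t), t)` and `y_{k+1}(t) = g (x_{k+1}(t), y_k(t), t)`. -/
structure DRP (E F : Type*) where
  T : ℝ
  f : E → F → ℝ → E
  g : E → F → ℝ → F

namespace DRP

variable {E F : Type*} [NormedAddCommGroup E] [NormedSpace ℝ E]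
  [NormedAddCommGroup F] [NormedSpace ℝ F]

/-- `(x, y)` obeys the process; the pass profiles `y k` are continuously differentiable on
`[0, T]`. The value `x 0` plays no role. -/
def IsTrajectory (S : DRP E F) (x : ℕ → ℝ → E) (y : ℕ → ℝ → F) : Prop :=
  (∀ k, ContDiffOn ℝ 1 (y k) (Icc 0 S.T)) ∧
  ∀ k, ∀ t ∈ Icc 0 S.T,
    HasDerivWithinAt (x (k + 1)) (S.f (x (k + 1) t) (y k t) t) (Icc 0 S.T) t ∧
    y (k + 1) t = S.g (x (k + 1) t) (y k t) t

/-- `(x, y)` is a trajectory with boundary data `y_0` and `x_{k+1}(0) = ξ k`. -/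
def IsSolution (S : DRP E F) (y₀ : ℝ → F) (ξ : ℕ → E) (x : ℕ → ℝ → E) (y : ℕ → ℝ → F) : Prop :=
  S.IsTrajectory x y ∧ EqOn (y 0) y₀ (Icc 0 S.T) ∧ ∀ k, x (k + 1) 0 = ξ k

/-- For the given boundary data all passes exist, and they are uniquely determined on `[0, T]`. -/
def HasUniqueSolution (S : DRP E F) (y₀ : ℝ → F) (ξ : ℕ → E) : Prop :=
  (∃ x y, S.IsSolution y₀ ξ x y) ∧
  ∀ x y x' y', S.IsSolution y₀ ξ x y → S.IsSolution y₀ ξ x' y' →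
    ∀ k, EqOn (x (k + 1)) (x' (k + 1)) (Icc 0 S.T) ∧ EqOn (y k) (y' k) (Icc 0 S.T)

/-- Lyapunov stability of the origin. -/
def LyapunovStable (S : DRP E F) : Prop :=
  ∀ ε : ℝ, 0 < ε → ∃ δ : ℝ, 0 < δ ∧ δ < ε ∧
    ∀ (y₀ : ℝ → F) (ξ : ℕ → E), ContDiffOn ℝ 1 y₀ (Icc 0 S.T) →
      passNorm S.T y₀ + expNorm 1 ξ < ENNReal.ofReal δ →
        S.HasUniqueSolution y₀ ξ ∧
        ∀ x y, S.IsSolution y₀ ξ x y → ∀ k, passNorm S.T (y k) < ENNReal.ofReal ε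

/-- Asymptotic stability of the origin. -/
def AsymptoticallyStable (S : DRP E F) : Prop :=
  S.LyapunovStable ∧
  ∃ δ : ℝ, 0 < δ ∧
    ∀ (y₀ : ℝ → F) (ξ : ℕ → E), ContDiffOn ℝ 1 y₀ (Icc 0 S.T) →
      passNorm S.T y₀ + expNorm 1 ξ < ENNReal.ofReal δ → Tendsto ξ atTop (𝓝 0) →
        S.HasUniqueSolution y₀ ξ ∧
        ∀ x y, S.IsSolution y₀ ξ x y → Tendsto (fun k => passNorm S.T (y k)) atTop (𝓝 0)

/-- (Local) exponential stability of the origin: the constants `K` and `γ` are continuous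
increasing functions of the rate `r` at which the initial states converge, while the radius `δ`
does not depend on `r`. -/
def ExponentiallyStable (S : DRP E F) : Prop :=
  S.AsymptoticallyStable ∧
  ∃ (δ : ℝ) (K γ : ℝ → ℝ), 0 < δ ∧
    ContinuousOn K (Ioo 0 1) ∧ StrictMonoOn K (Ioo 0 1) ∧ MapsTo K (Ioo 0 1) (Ici 1) ∧
    ContinuousOn γ (Ioo 0 1) ∧ StrictMonoOn γ (Ioo 0 1) ∧ MapsTo γ (Ioo 0 1) (Ioo 0 1) ∧
    ∀ r ∈ Ioo (0 : ℝ) 1, ∀ (y₀ : ℝ → F) (ξ : ℕ → E), ContDiffOn ℝ 1 y₀ (Icc 0 S.T) →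
      passNorm S.T y₀ + expNorm r ξ < ENNReal.ofReal δ →
        S.HasUniqueSolution y₀ ξ ∧
        ∀ x y, S.IsSolution y₀ ξ x y → ∀ k,
          passNorm S.T (y k) ≤
            ENNReal.ofReal (K r * γ r ^ k) * (passNorm S.T y₀ + expNorm r ξ)

end DRP

/-- A run of the learning scheme `u_{k+1} = u_k + l (e_k, t)`, `e_k = y_k - y_des`, on the plant
`x_k' = f (x_k, u_k, t)`, `y_k = g (x_k, u_k, t)` over `[0, T]`. -/
def IsILCRun {n m p : ℕ} (T : ℝ)
    (f : EuclideanSpace ℝ (Fin n) → EuclideanSpace ℝ (Fin m) → ℝ → EuclideanSpace ℝ (Fin n))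
    (g : EuclideanSpace ℝ (Fin n) → EuclideanSpace ℝ (Fin m) → ℝ → EuclideanSpace ℝ (Fin p))
    (l : EuclideanSpace ℝ (Fin p) → ℝ → EuclideanSpace ℝ (Fin m))
    (ydes : ℝ → EuclideanSpace ℝ (Fin p))
    (x : ℕ → ℝ → EuclideanSpace ℝ (Fin n)) (u : ℕ → ℝ → EuclideanSpace ℝ (Fin m))
    (y : ℕ → ℝ → EuclideanSpace ℝ (Fin p)) : Prop :=
  (∀ k, ContDiffOn ℝ 1 (u k) (Icc 0 T) ∧ ContDiffOn ℝ 1 (y k) (Icc 0 T)) ∧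
  ∀ k, ∀ t ∈ Icc 0 T,
    HasDerivWithinAt (x k) (f (x k t) (u k t) t) (Icc 0 T) t ∧
    y k t = g (x k t) (u k t) t ∧
    u (k + 1) t = u k t + l (y k t - ydes t) t

/-- The learning scheme as a differential repetitive process in deviations from the reference
`(xs, us)`: the state is `x_k - xs` and the pass profile is the pair `(e_k, u_k - us)`. The term
`f (xs t) (us t) t` is the derivative of `xs` at `t`. -/
def ilcProcess {n m p : ℕ} (T : ℝ)
    (f : EuclideanSpace ℝ (Fin n) → EuclideanSpace ℝ (Fin m) → ℝ → EuclideanSpace ℝ (Fin n))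
    (g : EuclideanSpace ℝ (Fin n) → EuclideanSpace ℝ (Fin m) → ℝ → EuclideanSpace ℝ (Fin p))
    (l : EuclideanSpace ℝ (Fin p) → ℝ → EuclideanSpace ℝ (Fin m))
    (ydes : ℝ → EuclideanSpace ℝ (Fin p))
    (xs : ℝ → EuclideanSpace ℝ (Fin n)) (us : ℝ → EuclideanSpace ℝ (Fin m)) :
    DRP (EuclideanSpace ℝ (Fin n)) (EuclideanSpace ℝ (Fin p) × EuclideanSpace ℝ (Fin m)) where
  T := T
  f := fun χ w t => f (χ + xs t) (w.2 + us t + l w.1 t) t - f (xs t) (us t) t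
  g := fun χ w t => (g (χ + xs t) (w.2 + us t + l w.1 t) t - ydes t, w.2 + l w.1 t)

/-- The Jacobian matrix of `h` at `v`. -/
noncomputable def jacobianMatrix {a b : ℕ}
    (h : EuclideanSpace ℝ (Fin a) → EuclideanSpace ℝ (Fin b)) (v : EuclideanSpace ℝ (Fin a)) :
    Matrix (Fin b) (Fin a) ℝ :=
  Matrix.of fun i j => fderiv ℝ h v (EuclideanSpace.single j 1) i

/-- The spectral radius of a real square matrix: the largest modulus of its complex
eigenvalues. -/
noncomputable def matrixRadius {ι : Type*} [Fintype ι] [DecidableEq ι] (M : Matrix ι ι ℝ) :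
    ℝ≥0∞ :=
  spectralRadius ℂ (M.map (algebraMap ℝ ℂ))

/-! In deviation coordinates the origin is an equilibrium, and at a fixed time `t` the linearized
map from one profile to the next (with zero state deviation) is `A = [D; I][L I]`. Nonzero
eigenvalues of `BC` and `CB` agree, so `A` has the spectral radius of `[L I][D; I] = I + LD`, which
is below 1. By Gelfand's formula `A ^ k → 0`, hence `A` contracts an equivalent norm `N`.

Since the process is `C^1`, this persists near `(0, 0, t)`, up to the state: `N (g χ w) ≤ q N w + K
‖χ‖` with `q < 1`. Compactness of `[0, T]` makes the constants uniform, while the norm `N t` may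
depend on `t` without any regularity (`StableLinearization.exists_tubeBound`).

The state is tamed by an exponential weight in time. If `N t (w t) ≤ a e^(αt)` and `‖ξ‖ ≤ b`, a
barrier argument gives `‖x t‖ ≤ (b + a/κ) e^(αt)`, where `κ` is arbitrarily large at the price of a
larger `α`. So one pass sends size `a` to at most `(1 + q)/2 * a + K b` (`exists_passContraction`).
The same bound keeps trajectories in the tube where the estimates hold, which gives existence and
uniqueness. All stability claims then follow from scalar recursions `a (k+1) ≥ q a k + K b k`. -/

/-! ### Adapted norms for power-stable operators. -/

section AdaptedNorm

variable {F : Type*} [NormedAddCommGroup F] [NormedSpace ℝ F]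

/-- A power-stable operator is a contraction for an equivalent norm. -/
theorem exists_adapted_norm (A : F →L[ℝ] F) (hA : Tendsto (fun k => A ^ k) atTop (𝓝 0)) :
    ∃ (N : F → ℝ) (M q : ℝ), 1 ≤ M ∧ 0 ≤ q ∧ q < 1 ∧ (∀ u v, N (u + v) ≤ N u + N v) ∧
      (∀ v, ‖v‖ ≤ N v) ∧ (∀ v, N v ≤ M * ‖v‖) ∧ ∀ v, N (A v) ≤ q * N v := by
  have h1 : ∀ᶠ k in atTop, ‖A ^ k‖ < 1 / 2 := by
    have := hA.norm
    rw [norm_zero] at this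
    exact this.eventually (gt_mem_nhds (by norm_num))
  obtain ⟨n, hn, hn1⟩ := (h1.and (eventually_ge_atTop 1)).exists
  set M : ℝ := 1 + ∑ j ∈ Finset.range n, ‖A ^ j‖ with hM
  have hM1 : 1 ≤ M := by
    have : 0 ≤ ∑ j ∈ Finset.range n, ‖A ^ j‖ := Finset.sum_nonneg fun _ _ => norm_nonneg _
    linarith
  have hup : ∀ v, ∑ j ∈ Finset.range n, ‖(A ^ j) v‖ ≤ M * ‖v‖ := fun v => by
    calc ∑ j ∈ Finset.range n, ‖(A ^ j) v‖ ≤ ∑ j ∈ Finset.range n, ‖A ^ j‖ * ‖v‖ :=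
          Finset.sum_le_sum fun j _ => (A ^ j).le_opNorm v
      _ = (∑ j ∈ Finset.range n, ‖A ^ j‖) * ‖v‖ := by rw [Finset.sum_mul]
      _ ≤ M * ‖v‖ := by gcongr; linarith
  -- With `N v = ∑_{j<n} ‖A ^ j v‖` and `‖A ^ n‖ < 1/2`, telescoping gives `N (A v) = N v - ‖v‖ + ‖A
  -- ^ n v‖ ≤ N v - ‖v‖/2`, and `‖v‖ ≥ N v / M` turns the gain into a factor. The requirement `n ≥
  -- 1` puts `‖v‖` among the summands.
  refine ⟨fun v => ∑ j ∈ Finset.range n, ‖(A ^ j) v‖, M, 1 - 1 / (2 * M), hM1, ?_, ?_, ?_, ?_,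
    hup, ?_⟩
  · rw [sub_nonneg, div_le_one (by positivity)]; linarith
  · have : 0 < 1 / (2 * M) := by positivity
    linarith
  · intro u v
    rw [← Finset.sum_add_distrib]
    exact Finset.sum_le_sum fun j _ => by rw [map_add]; exact norm_add_le _ _
  · intro v
    have := Finset.single_le_sum (f := fun j => ‖(A ^ j) v‖) (fun j _ => norm_nonneg _)
      (Finset.mem_range.2 hn1)
    simpa using this
  · intro v
    have h2 : ∑ j ∈ Finset.range n, ‖(A ^ j) (A v)‖ + ‖v‖ =
        ∑ j ∈ Finset.range n, ‖(A ^ j) v‖ + ‖(A ^ n) v‖ := by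
      rw [← Finset.sum_range_succ (fun j => ‖(A ^ j) v‖), Finset.sum_range_succ']
      simp [pow_succ]
    have h3 : ‖(A ^ n) v‖ ≤ 1 / 2 * ‖v‖ := (A ^ n).le_of_opNorm_le hn.le v
    have h4 : 1 / (2 * M) * ∑ j ∈ Finset.range n, ‖(A ^ j) v‖ ≤ 1 / 2 * ‖v‖ := by
      calc _ ≤ 1 / (2 * M) * (M * ‖v‖) := by gcongr; exact hup v
        _ = 1 / 2 * ‖v‖ := by field_simp
    simp only [sub_mul, one_mul]
    linarith

end AdaptedNorm

/-! ### Strict differentiability within a convex set. -/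

section StrictEstimate

variable {E G : Type*} [NormedAddCommGroup E] [NormedSpace ℝ E]
  [NormedAddCommGroup G] [NormedSpace ℝ G]

/-- A function which is `C^1` within a convex set has a strict derivative there. -/
theorem ContDiffWithinAt.exists_strict_estimate {f : E → G} {s : Set E} {x : E}
    (hf : ContDiffWithinAt ℝ 1 f s x) (hs : Convex ℝ s) (hx : x ∈ s) :
    ∃ f' : E →L[ℝ] G, HasFDerivWithinAt f f' s x ∧ ∀ η > 0, ∃ u ∈ 𝓝[s] x,
      ∀ y ∈ u, ∀ z ∈ u, ‖f y - f z - f' (y - z)‖ ≤ η * ‖y - z‖ := by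
  rw [show (1 : WithTop ℕ∞) = 0 + 1 from rfl,
    contDiffWithinAt_succ_iff_hasFDerivWithinAt' (by simp)] at hf
  obtain ⟨u, hu, hus, -, f', hf', hc⟩ := hf
  rw [insert_eq_of_mem hx] at hu hus
  refine ⟨f' x, hf' x (mem_of_mem_nhdsWithin hx hu), fun η hη => ?_⟩
  lift η to NNReal using hη.le
  have hc' : ContinuousWithinAt (fun y => f' y - f' x) s x := by
    have h := hc.continuousWithinAt
    exact h.sub continuousWithinAt_const
  -- Mean value inequality for `f` minus its linearization at `x`, whose derivative vanishes at `x`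
  -- and is continuous there.
  obtain ⟨t, ht, hlip⟩ := hs.exists_nhdsWithin_lipschitzOnWith_of_hasFDerivWithinAt_of_nnnorm_lt
    (f := fun y => f y - f' x y) (f' := fun y => f' y - f' x)
    (Filter.mem_of_superset hu fun y hy => (hf' y hy).sub (f' x).hasFDerivWithinAt) hc' η
    (by simpa using hη)
  refine ⟨t, ht, fun y hy z hz => ?_⟩
  have := hlip.norm_sub_le hy hz
  simpa [map_sub, sub_sub_sub_comm] using this

end StrictEstimate

/-! ### Truncation onto a ball. -/

section RadialRetraction

variable {E : Type*} [NormedAddCommGroup E] [NormedSpace ℝ E]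

/-- The radial retraction onto the closed ball of radius `r` around the origin. -/
noncomputable def radialRetraction (r : ℝ) (x : E) : E := (r / max r ‖x‖) • x

theorem norm_radialRetraction_le {r : ℝ} (hr : 0 < r) (x : E) : ‖radialRetraction r x‖ ≤ r := by
  have hm : 0 < max r ‖x‖ := lt_max_of_lt_left hr
  rw [radialRetraction, norm_smul, Real.norm_of_nonneg (by positivity), div_mul_eq_mul_div,
    div_le_iff₀ hm]
  gcongr
  exact le_max_right _ _

theorem radialRetraction_eq_self {r : ℝ} (hr : 0 < r) {x : E} (hx : ‖x‖ ≤ r) :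
    radialRetraction r x = x := by
  rw [radialRetraction, max_eq_left hx, div_self hr.ne', one_smul]

/-- Moving the point and changing the scaling factor each cost at most `‖x - y‖`; no inner product
is needed for the constant 2. -/
theorem norm_radialRetraction_sub_le {r : ℝ} (hr : 0 < r) (x y : E) :
    ‖radialRetraction r x - radialRetraction r y‖ ≤ 2 * ‖x - y‖ := by
  have hx : 0 < max r ‖x‖ := lt_max_of_lt_left hr
  have hy : 0 < max r ‖y‖ := lt_max_of_lt_left hr
  have h1 : radialRetraction r x - radialRetraction r y =
      (r / max r ‖x‖) • (x - y) + (r / max r ‖x‖ - r / max r ‖y‖) • y := by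
    simp only [radialRetraction, smul_sub, sub_smul]; abel
  have h2 : ‖(r / max r ‖x‖) • (x - y)‖ ≤ ‖x - y‖ := by
    rw [norm_smul, Real.norm_of_nonneg (by positivity)]
    exact mul_le_of_le_one_left (norm_nonneg _) ((div_le_one hx).2 (le_max_left _ _))
  have h3 : ‖(r / max r ‖x‖ - r / max r ‖y‖) • y‖ ≤ ‖x - y‖ := by
    have e : r / max r ‖x‖ - r / max r ‖y‖ =
        (r / max r ‖x‖) * (max r ‖y‖ - max r ‖x‖) / max r ‖y‖ := by field_simp
    have h4 : |max r ‖y‖ - max r ‖x‖| ≤ ‖x - y‖ := by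
      refine (abs_max_sub_max_le_max r ‖y‖ r ‖x‖).trans ?_
      rw [sub_self, abs_zero, max_eq_right (abs_nonneg _), abs_sub_comm]
      exact abs_norm_sub_norm_le x y
    rw [norm_smul, e, Real.norm_eq_abs, abs_div, abs_mul, abs_of_pos hy,
      abs_of_nonneg (by positivity : 0 ≤ r / max r ‖x‖), div_mul_eq_mul_div, div_le_iff₀ hy]
    calc r / max r ‖x‖ * |max r ‖y‖ - max r ‖x‖| * ‖y‖ ≤ 1 * ‖x - y‖ * max r ‖y‖ := by
          gcongr
          · exact (div_le_one hx).2 (le_max_left _ _)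
          · exact le_max_right _ _
      _ = _ := by ring
  rw [h1]
  linarith [norm_add_le ((r / max r ‖x‖) • (x - y)) ((r / max r ‖x‖ - r / max r ‖y‖) • y)]

end RadialRetraction

/-! ### Differential equations controlled only inside a tube. -/

section TubeODE

variable {E : Type*} [NormedAddCommGroup E] [NormedSpace ℝ E] {T r K κ a c : ℝ} {v : ℝ → E → E}
  {x x' : ℝ → E}

/-- A solution of `x' = v (t, x)` which starts below the exponential barrier stays there. -/
theorem norm_le_mul_exp_of_hasDerivWithinAt (hK : 0 ≤ K) (hκ : 0 ≤ κ) (hc : 0 < c)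
    (hv : ∀ t ∈ Icc 0 T, ∀ χ : E, ‖χ‖ ≤ r →
      ‖v t χ‖ ≤ K * (‖χ‖ + a * Real.exp ((K + K * κ + 1) * t)))
    (hac : a ≤ κ * c) (hcr : c * Real.exp ((K + K * κ + 1) * T) ≤ r)
    (hx : ∀ t ∈ Icc 0 T, HasDerivWithinAt x (v t (x t)) (Icc 0 T) t) (hx0 : ‖x 0‖ ≤ c) :
    ∀ t ∈ Icc 0 T, ‖x t‖ ≤ c * Real.exp ((K + K * κ + 1) * t) := by
  set α := K + K * κ + 1 with hα
  have hα0 : 0 ≤ α := by positivity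
  refine image_norm_le_of_norm_deriv_right_lt_deriv_boundary (f' := fun t => v t (x t))
    (B' := fun t => c * (Real.exp (α * t) * α)) (fun t ht => (hx t ht).continuousWithinAt)
    (fun t ht => ?_) (by simpa using hx0) (fun t => ?_) fun t ht hb => ?_
  · exact (hx t (Ico_subset_Icc_self ht)).mono_of_mem_nhdsWithin
      (mem_of_superset (Ico_mem_nhdsGE ht.2)
        ((Ico_subset_Ico_left ht.1).trans Ico_subset_Icc_self))
  · have h : HasDerivAt (fun t => α * t) α t := by simpa using (hasDerivAt_id t).const_mul α
    exact h.exp.const_mul c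
  -- On contact with the barrier `c e^(αt)` the speed is at most `K (1 + κ) c e^(αt)`. The barrier
  -- grows at rate `α c e^(αt)`, and the `+ 1` in `α` makes this strictly larger.
  · have he : Real.exp (α * t) ≤ Real.exp (α * T) := Real.exp_le_exp.2 (by nlinarith [ht.2])
    have h1 := hv t (Ico_subset_Icc_self ht) (x t) (hb ▸ (by nlinarith))
    rw [hb] at h1
    have h0 := Real.exp_pos (α * t)
    refine h1.trans_lt ?_
    calc K * (c * Real.exp (α * t) + a * Real.exp (α * t))
        ≤ K * (c * Real.exp (α * t) + κ * c * Real.exp (α * t)) := by gcongr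
      _ < c * (Real.exp (α * t) * α) := by
        have : 0 < c * Real.exp (α * t) := by positivity
        rw [hα]; nlinarith

/-- Composing the field with the radial retraction makes it globally bounded and Lipschitz, so
Picard–Lindelöf reaches all of `[0, T]`. The barrier keeps the resulting solution in the ball, where
the truncation changes nothing. -/
theorem exists_solution_of_tube [CompleteSpace E] (hT : 0 ≤ T) (hK : 0 ≤ K) (hκ : 0 ≤ κ)
    (hc : 0 < c) (ha : 0 ≤ a)
    (hv : ∀ t ∈ Icc 0 T, ∀ χ : E, ‖χ‖ ≤ r →
      ‖v t χ‖ ≤ K * (‖χ‖ + a * Real.exp ((K + K * κ + 1) * t)))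
    (hlip : ∀ t ∈ Icc 0 T, ∀ χ χ' : E, ‖χ‖ ≤ r → ‖χ'‖ ≤ r → ‖v t χ - v t χ'‖ ≤ K * ‖χ - χ'‖)
    (hcont : ∀ χ : E, ‖χ‖ ≤ r → ContinuousOn (fun t => v t χ) (Icc 0 T))
    (hac : a ≤ κ * c) (hcr : c * Real.exp ((K + K * κ + 1) * T) ≤ r) {ξ : E} (hξ : ‖ξ‖ ≤ c) :
    ∃ x : ℝ → E, x 0 = ξ ∧ ∀ t ∈ Icc 0 T, HasDerivWithinAt x (v t (x t)) (Icc 0 T) t := by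
  have hr : 0 < r := lt_of_lt_of_le (by positivity) hcr
  set α := K + K * κ + 1 with hα
  have hα0 : 0 ≤ α := by positivity
  set V : ℝ → E → E := fun t χ => v t (radialRetraction r χ) with hV
  set B : ℝ := K * (r + a * Real.exp (α * T)) with hB
  have hB0 : 0 ≤ B := by positivity
  have hpl : IsPicardLindelof V (⟨0, left_mem_Icc.2 hT⟩ : Icc 0 T) ξ (B * T).toNNReal 0
      B.toNNReal (2 * K).toNNReal := by
    refine ⟨fun t ht => ?_, fun χ _ => hcont _ (norm_radialRetraction_le hr χ), ?_, ?_⟩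
    · refine LipschitzOnWith.of_dist_le_mul fun χ _ χ' _ => ?_
      rw [dist_eq_norm, dist_eq_norm, Real.coe_toNNReal _ (by positivity)]
      calc _ ≤ K * ‖radialRetraction r χ - radialRetraction r χ'‖ :=
            hlip t ht _ _ (norm_radialRetraction_le hr _) (norm_radialRetraction_le hr _)
        _ ≤ K * (2 * ‖χ - χ'‖) := by gcongr; exact norm_radialRetraction_sub_le hr _ _
        _ = _ := by ring
    · intro t ht χ _
      rw [Real.coe_toNNReal _ hB0]
      refine (hv t ht _ (norm_radialRetraction_le hr χ)).trans ?_
      have : Real.exp (α * t) ≤ Real.exp (α * T) := Real.exp_le_exp.2 (by nlinarith [ht.2])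
      rw [hB]
      gcongr
      exact norm_radialRetraction_le hr χ
    · rw [Real.coe_toNNReal _ hB0, Real.coe_toNNReal _ (by positivity)]
      simp [hT]
  obtain ⟨x, hx0, hx⟩ := hpl.exists_eq_forall_mem_Icc_hasDerivWithinAt₀
  refine ⟨x, hx0, fun t ht => ?_⟩
  have hb := norm_le_mul_exp_of_hasDerivWithinAt (v := V) (x := x) (T := T) (r := r) hK hκ hc
    (fun t ht χ hχ => by
      simpa only [hV, radialRetraction_eq_self hr hχ] using hv t ht χ hχ) hac hcr hx
    (by rw [show x 0 = ξ from hx0]; exact hξ) t ht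
  have hxr : ‖x t‖ ≤ r := hb.trans (le_trans (by
    have : Real.exp (α * t) ≤ Real.exp (α * T) := Real.exp_le_exp.2 (by nlinarith [ht.2])
    gcongr) hcr)
  simpa only [hV, radialRetraction_eq_self hr hxr] using hx t ht

theorem eqOn_of_tube (hK : 0 ≤ K)
    (hlip : ∀ t ∈ Icc 0 T, ∀ χ χ' : E, ‖χ‖ ≤ r → ‖χ'‖ ≤ r → ‖v t χ - v t χ'‖ ≤ K * ‖χ - χ'‖)
    (hx : ∀ t ∈ Icc 0 T, HasDerivWithinAt x (v t (x t)) (Icc 0 T) t)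
    (hx' : ∀ t ∈ Icc 0 T, HasDerivWithinAt x' (v t (x' t)) (Icc 0 T) t)
    (hr : ∀ t ∈ Icc 0 T, ‖x t‖ ≤ r) (hr' : ∀ t ∈ Icc 0 T, ‖x' t‖ ≤ r) (h0 : x 0 = x' 0) :
    EqOn x x' (Icc 0 T) := by
  have key : ∀ t ∈ Ico 0 T, Icc 0 T ∈ 𝓝[≥] t := fun t ht =>
    mem_of_superset (Ico_mem_nhdsGE ht.2) ((Ico_subset_Ico_left ht.1).trans Ico_subset_Icc_self)
  refine ODE_solution_unique_of_mem_Icc_right (v := v) (K := K.toNNReal)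
    (s := fun _ => {χ | ‖χ‖ ≤ r}) (fun t ht => ?_) (fun t ht => (hx t ht).continuousWithinAt)
    (fun t ht => (hx t (Ico_subset_Icc_self ht)).mono_of_mem_nhdsWithin (key t ht))
    (fun t ht => hr t (Ico_subset_Icc_self ht)) (fun t ht => (hx' t ht).continuousWithinAt)
    (fun t ht => (hx' t (Ico_subset_Icc_self ht)).mono_of_mem_nhdsWithin (key t ht))
    (fun t ht => hr' t (Ico_subset_Icc_self ht)) h0
  refine LipschitzOnWith.of_dist_le_mul fun χ hχ χ' hχ' => ?_
  rw [dist_eq_norm, dist_eq_norm, Real.coe_toNNReal _ hK]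
  exact hlip t (Ico_subset_Icc_self ht) χ χ' hχ hχ'

end TubeODE

/-! ### Uniform estimates near the equilibrium. -/

namespace DRP

section Tube

variable {E F : Type*} [NormedAddCommGroup E] [NormedSpace ℝ E]
  [NormedAddCommGroup F] [NormedSpace ℝ F]

/-- The slab of all `(χ, w, t)` with `t ∈ [0, T]`. -/
def passSlab (E F : Type*) (T : ℝ) : Set (E × F × ℝ) := {z | z.2.2 ∈ Icc 0 T}

theorem convex_passSlab (T : ℝ) : Convex ℝ (passSlab E F T) := by
  exact (convex_Icc (0 : ℝ) T).linear_preimage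
    ((LinearMap.snd ℝ F ℝ).comp (LinearMap.snd ℝ E (F × ℝ)))

/-- The process is `C^1` near the origin at each time of the pass, the origin is an equilibrium,
and the linearized pass-to-pass map is power stable at each time. -/
structure StableLinearization (S : DRP E F) : Prop where
  T_nonneg : 0 ≤ S.T
  f_zero : ∀ t ∈ Icc 0 S.T, S.f 0 0 t = 0
  g_zero : ∀ t ∈ Icc 0 S.T, S.g 0 0 t = 0
  contDiff_f : ∀ t ∈ Icc 0 S.T, ContDiffWithinAt ℝ 1
    (fun z : E × F × ℝ => S.f z.1 z.2.1 z.2.2) (passSlab E F S.T) (0, 0, t)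
  contDiff_g : ∀ t ∈ Icc 0 S.T, ContDiffWithinAt ℝ 1
    (fun z : E × F × ℝ => S.g z.1 z.2.1 z.2.2) (passSlab E F S.T) (0, 0, t)
  powerStable : ∀ t ∈ Icc 0 S.T, ∃ A : F →L[ℝ] F,
    HasFDerivAt (fun w => S.g 0 w t) A 0 ∧ Tendsto (fun k => A ^ k) atTop (𝓝 0)

/-- Bounds for the process at time `t` for states and profiles of norm at most `r`, where the
profiles are also measured by the equivalent norm `N`. -/
structure TubeBound (S : DRP E F) (r K M q : ℝ) (N : F → ℝ) (t : ℝ) : Prop where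
  norm_le : ∀ v, ‖v‖ ≤ N v
  le_norm : ∀ v, N v ≤ M * ‖v‖
  lip : ∀ χ χ' w, ‖χ‖ ≤ r → ‖χ'‖ ≤ r → ‖w‖ ≤ r → ‖S.f χ w t - S.f χ' w t‖ ≤ K * ‖χ - χ'‖
  f_le : ∀ χ w, ‖χ‖ ≤ r → ‖w‖ ≤ r → ‖S.f χ w t‖ ≤ K * (‖χ‖ + ‖w‖)
  g_le : ∀ χ w, ‖χ‖ ≤ r → ‖w‖ ≤ r → N (S.g χ w t) ≤ q * N w + K * ‖χ‖
  contDiff_f : ∀ χ w, ‖χ‖ ≤ r → ‖w‖ ≤ r → ContDiffWithinAt ℝ 1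
    (fun z : E × F × ℝ => S.f z.1 z.2.1 z.2.2) (passSlab E F S.T) (χ, w, t)
  contDiff_g : ∀ χ w, ‖χ‖ ≤ r → ‖w‖ ≤ r → ContDiffWithinAt ℝ 1
    (fun z : E × F × ℝ => S.g z.1 z.2.1 z.2.2) (passSlab E F S.T) (χ, w, t)

theorem TubeBound.mono {S : DRP E F} {r K M q r' K' M' q' : ℝ} {N : F → ℝ} {t : ℝ}
    (h : S.TubeBound r K M q N t) (hr : r' ≤ r) (hK : K ≤ K') (hM : M ≤ M') (hq : q ≤ q') :
    S.TubeBound r' K' M' q' N t where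
  norm_le := h.norm_le
  le_norm v := (h.le_norm v).trans (by gcongr)
  lip χ χ' w h1 h2 h3 :=
    (h.lip χ χ' w (h1.trans hr) (h2.trans hr) (h3.trans hr)).trans (by gcongr)
  f_le χ w h1 h2 := (h.f_le χ w (h1.trans hr) (h2.trans hr)).trans (by gcongr)
  g_le χ w h1 h2 := (h.g_le χ w (h1.trans hr) (h2.trans hr)).trans (by
    have := (norm_nonneg w).trans (h.norm_le w)
    gcongr)
  contDiff_f χ w h1 h2 := h.contDiff_f χ w (h1.trans hr) (h2.trans hr)
  contDiff_g χ w h1 h2 := h.contDiff_g χ w (h1.trans hr) (h2.trans hr)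

/-- One norm, adapted to the linearization at `t₀`, serves all nearby times, because the strict
derivative of `g` at `(0, 0, t₀)` controls increments between points sharing a nearby time `t`. -/
theorem StableLinearization.exists_tubeBound_near {S : DRP E F} (hS : S.StableLinearization)
    {t₀ : ℝ} (ht₀ : t₀ ∈ Icc 0 S.T) :
    ∃ r K M q : ℝ, 0 < r ∧ 0 ≤ K ∧ 1 ≤ M ∧ 0 ≤ q ∧ q < 1 ∧ ∃ N : F → ℝ,
      ∀ᶠ t in 𝓝[Icc 0 S.T] t₀, S.TubeBound r K M q N t := by
  set Z := passSlab E F S.T with hZ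
  have hz : ((0 : E), (0 : F), t₀) ∈ Z := ht₀
  obtain ⟨A, hA, hApow⟩ := hS.powerStable t₀ ht₀
  obtain ⟨N, M, q, hM, hq0, hq1, hNadd, hN1, hN2, hNA⟩ := exists_adapted_norm A hApow
  obtain ⟨Kf, u, hu, hlip⟩ :=
    (hS.contDiff_f t₀ ht₀).exists_lipschitzOnWith (convex_passSlab _)
  obtain ⟨g', hg', hstrict⟩ :=
    (hS.contDiff_g t₀ ht₀).exists_strict_estimate (convex_passSlab _) hz
  -- Fixing the time keeps the `w`-directions inside the slab, so the derivative within the slab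
  -- restricts to the ordinary derivative in `w`.
  have hg'A : ∀ w, g' (0, w, 0) = A w := by
    intro w
    have h1 : HasFDerivAt (fun w : F => ((0 : E), w, t₀))
        ((0 : F →L[ℝ] E).prod ((ContinuousLinearMap.id ℝ F).prod 0)) 0 :=
      (hasFDerivAt_const _ _).prodMk ((hasFDerivAt_id _).prodMk (hasFDerivAt_const _ _))
    have h2 := HasFDerivWithinAt.comp (s := univ) (0 : F) hg'
      h1.hasFDerivWithinAt (fun w _ => (show (0, w, t₀) ∈ Z from ht₀))
    rw [hasFDerivWithinAt_univ] at h2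
    have h3 := h2.unique hA
    rw [← h3]
    simp
  -- Then `M * η = (1 - q)/2`, so the nonlinear error raises the contraction factor from `q` to `(1
  -- + q)/2` only.
  set η : ℝ := (1 - q) / (2 * M) with hη
  have hη0 : 0 < η := div_pos (by linarith) (by linarith)
  obtain ⟨u', hu', hest⟩ := hstrict η hη0
  have hcf := (hS.contDiff_f t₀ ht₀).eventually (by simp)
  have hcg := (hS.contDiff_g t₀ ht₀).eventually (by simp)
  rw [insert_eq_of_mem hz] at hcf hcg
  obtain ⟨ε, hε, hball⟩ := Metric.mem_nhdsWithin_iff.1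
    (inter_mem (inter_mem hu hu') (inter_mem hcf hcg))
  have hmem : ∀ t ∈ Icc 0 S.T, dist t t₀ < ε → ∀ (χ : E) (w : F), ‖χ‖ ≤ ε / 2 → ‖w‖ ≤ ε / 2 →
      (χ, w, t) ∈ Metric.ball ((0 : E), (0 : F), t₀) ε ∩ Z := by
    intro t ht htε χ w hχ hw
    refine ⟨?_, ht⟩
    simp only [Metric.mem_ball, Prod.dist_eq, dist_zero_right, max_lt_iff]
    exact ⟨by linarith, by linarith, htε⟩
  refine ⟨ε / 2, max Kf (M * (‖g'‖ + η)), M, (1 + q) / 2, by positivity, by positivity, hM,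
    by linarith, by linarith, N, ?_⟩
  filter_upwards [self_mem_nhdsWithin, mem_nhdsWithin_of_mem_nhds (Metric.ball_mem_nhds t₀ hε)]
    with t ht htε
  have h0 : ‖(0 : E)‖ ≤ ε / 2 := by rw [norm_zero]; positivity
  have h0' : ‖(0 : F)‖ ≤ ε / 2 := by rw [norm_zero]; positivity
  have hm := fun χ w hχ hw => hball (hmem t ht htε χ w hχ hw)
  refine ⟨hN1, hN2, ?_, ?_, ?_, fun χ w hχ hw => (hm χ w hχ hw).2.1,
    fun χ w hχ hw => (hm χ w hχ hw).2.2⟩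
  · intro χ χ' w hχ hχ' hw
    refine (hlip.norm_sub_le (hm χ w hχ hw).1.1 (hm χ' w hχ' hw).1.1).trans ?_
    have : ‖((χ, w, t) : E × F × ℝ) - (χ', w, t)‖ = ‖χ - χ'‖ := by simp [Prod.norm_def]
    rw [this]
    gcongr
    exact le_max_left _ _
  · intro χ w hχ hw
    have h1 := hlip.norm_sub_le (hm χ w hχ hw).1.1 (hm 0 0 h0 h0').1.1
    have h2 : ‖((χ, w, t) : E × F × ℝ) - (0, 0, t)‖ ≤ ‖χ‖ + ‖w‖ := by
      simp [Prod.norm_def]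
    simp only [hS.f_zero t ht, sub_zero] at h1
    refine h1.trans ?_
    gcongr
    exact le_max_left _ _
  · intro χ w hχ hw
    have h1 := hest _ (hm χ w hχ hw).1.2 _ (hm 0 0 h0 h0').1.2
    have h2 : ‖((χ, w, t) : E × F × ℝ) - (0, 0, t)‖ ≤ ‖χ‖ + ‖w‖ := by
      simp [Prod.norm_def]
    have h3 : g' (((χ, w, t) : E × F × ℝ) - (0, 0, t)) = g' (χ, 0, 0) + A w := by
      rw [← hg'A, ← map_add]; simp
    have h4 : ‖g' (χ, (0 : F), (0 : ℝ))‖ ≤ ‖g'‖ * ‖χ‖ := by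
      refine (g'.le_opNorm _).trans (by simp [Prod.norm_def])
    rw [h3] at h1
    simp only [hS.g_zero t ht, sub_zero] at h1
    have h5 : ‖S.g χ w t - A w‖ ≤ (‖g'‖ + η) * ‖χ‖ + η * ‖w‖ := by
      have e : S.g χ w t - A w = (S.g χ w t - (g' (χ, 0, 0) + A w)) + g' (χ, 0, 0) := by abel
      rw [e]
      refine (norm_add_le _ _).trans ?_
      have := h1.trans (mul_le_mul_of_nonneg_left h2 hη0.le)
      linarith
    have hwN := hN1 w
    have hMη : M * η = (1 - q) / 2 := by rw [hη]; field_simp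
    calc N (S.g χ w t) = N (A w + (S.g χ w t - A w)) := by congr 1; abel
      _ ≤ q * N w + M * ((‖g'‖ + η) * ‖χ‖ + η * ‖w‖) :=
        (hNadd _ _).trans (add_le_add (hNA w) ((hN2 _).trans (by gcongr)))
      _ = q * N w + M * η * ‖w‖ + M * (‖g'‖ + η) * ‖χ‖ := by ring
      _ ≤ q * N w + (1 - q) / 2 * N w + max (Kf : ℝ) (M * (‖g'‖ + η)) * ‖χ‖ := by
        rw [hMη]
        have : 0 ≤ (1 - q) / 2 := by linarith
        gcongr
        exact le_max_right _ _
      _ = _ := by ring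

/-- The bounds are stable under unions of two time sets, by taking the worse constants, so
compactness yields uniform constants. The norms are chosen separately at each time. -/
theorem StableLinearization.exists_tubeBound {S : DRP E F} (hS : S.StableLinearization) :
    ∃ r K M q : ℝ, 0 < r ∧ 0 ≤ K ∧ 1 ≤ M ∧ 0 ≤ q ∧ q < 1 ∧ ∃ N : ℝ → F → ℝ,
      ∀ t ∈ Icc 0 S.T, S.TubeBound r K M q (N t) t := by
  have key : ∃ r K M q : ℝ, 0 < r ∧ 0 ≤ K ∧ 1 ≤ M ∧ 0 ≤ q ∧ q < 1 ∧
      ∀ t ∈ Icc 0 S.T, ∃ N : F → ℝ, S.TubeBound r K M q N t := by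
    refine isCompact_Icc.induction_on (s := Icc 0 S.T)
      (p := fun I => ∃ r K M q : ℝ, 0 < r ∧ 0 ≤ K ∧ 1 ≤ M ∧ 0 ≤ q ∧ q < 1 ∧
        ∀ t ∈ I, ∃ N : F → ℝ, S.TubeBound r K M q N t) ?_ ?_ ?_ ?_
    · exact ⟨1, 0, 1, 0, one_pos, le_rfl, le_rfl, le_rfl, one_pos, by simp⟩
    · rintro I J hIJ ⟨r, K, M, q, h1, h2, h3, h4, h5, h⟩
      exact ⟨r, K, M, q, h1, h2, h3, h4, h5, fun t ht => h t (hIJ ht)⟩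
    · rintro I J ⟨r, K, M, q, h1, h2, h3, h4, h5, h⟩ ⟨r', K', M', q', h1', h2', h3', h4', h5', h'⟩
      refine ⟨min r r', max K K', max M M', max q q', lt_min h1 h1', le_max_of_le_left h2,
        le_max_of_le_left h3, le_max_of_le_left h4, max_lt h5 h5', ?_⟩
      rintro t (ht | ht)
      · obtain ⟨N, hN⟩ := h t ht
        exact ⟨N, hN.mono (min_le_left _ _) (le_max_left _ _) (le_max_left _ _) (le_max_left _ _)⟩
      · obtain ⟨N, hN⟩ := h' t ht
        exact ⟨N, hN.mono (min_le_right _ _) (le_max_right _ _) (le_max_right _ _)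
          (le_max_right _ _)⟩
    · intro t₀ ht₀
      obtain ⟨r, K, M, q, h1, h2, h3, h4, h5, N, h⟩ := hS.exists_tubeBound_near ht₀
      exact ⟨_, h, r, K, M, q, h1, h2, h3, h4, h5, fun t ht => ⟨N, ht⟩⟩
  obtain ⟨r, K, M, q, h1, h2, h3, h4, h5, h⟩ := key
  choose! N hN using h
  exact ⟨r, K, M, q, h1, h2, h3, h4, h5, N, hN⟩

end Tube

end DRP

/-- A function with a continuous derivative on `[0, T]` is `C^1` there, also if `T = 0`. -/
theorem contDiffOn_one_Icc_of_hasDerivWithinAt {E : Type*} [NormedAddCommGroup E]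
    [NormedSpace ℝ E] {T : ℝ} {x x' : ℝ → E}
    (hx : ∀ t ∈ Icc 0 T, HasDerivWithinAt x (x' t) (Icc 0 T) t)
    (hx' : ContinuousOn x' (Icc 0 T)) : ContDiffOn ℝ 1 x (Icc 0 T) := by
  rcases lt_or_ge 0 T with hT | hT
  · have hu := uniqueDiffOn_Icc hT
    rw [contDiffOn_one_iff_derivWithin hu]
    exact ⟨fun t ht => (hx t ht).differentiableWithinAt,
      hx'.congr fun t ht => (hx t ht).derivWithin (hu t ht)⟩
  · intro t ht
    have h0 : Icc 0 T ⊆ {t} := fun s hs => by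
      have h1 : s = 0 := le_antisymm (hs.2.trans hT) hs.1
      have h2 : t = 0 := le_antisymm (ht.2.trans hT) ht.1
      simp [h1, h2]
    exact contDiffWithinAt_singleton.mono h0

/-! ### One pass as a contraction in an exponentially weighted size. -/

namespace DRP

variable {E F : Type*} [NormedAddCommGroup E] [NormedSpace ℝ E]
  [NormedAddCommGroup F] [NormedSpace ℝ F]

/-- `x` is the state during a pass with the previous pass profile `w` and the initial state `ξ`. -/
def IsPass (S : DRP E F) (w : ℝ → F) (ξ : E) (x : ℝ → E) : Prop :=
  x 0 = ξ ∧ ∀ t ∈ Icc 0 S.T, HasDerivWithinAt x (S.f (x t) (w t) t) (Icc 0 S.T) t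

theorem IsPass.congr {G : Type*} {S : DRP E G} {w w' : ℝ → G} {ξ : E} {x : ℝ → E} (h : S.IsPass w ξ x)
    (hw : EqOn w w' (Icc 0 S.T)) : S.IsPass w' ξ x :=
  ⟨h.1, fun t ht => hw ht ▸ h.2 t ht⟩

/-- `P a w` expresses that the profile `w` has size at most `a` in a sense in which one pass
contracts profiles by the factor `q`, up to the effect of the initial state. -/
structure PassContraction (S : DRP E F) (P : ℝ → (ℝ → F) → Prop) (ρ H q K M : ℝ) : Prop where
  contDiffOn : ∀ a w, P a w → ContDiffOn ℝ 1 w (Icc 0 S.T)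
  norm_le : ∀ a w, P a w → ∀ t ∈ Icc 0 S.T, ‖w t‖ ≤ H * a
  of_norm_le : ∀ s w, ContDiffOn ℝ 1 w (Icc 0 S.T) → 0 ≤ s → (∀ t ∈ Icc 0 S.T, ‖w t‖ ≤ s) →
    P (M * s) w
  mono : ∀ a a' w, P a w → a ≤ a' → P a' w
  congr : ∀ a w w', P a w → EqOn w' w (Icc 0 S.T) → P a w'
  exists_isPass : ∀ a b w ξ, 0 ≤ a → P a w → ‖ξ‖ ≤ b → a + b < ρ → ∃ x, S.IsPass w ξ x
  eqOn : ∀ a b w ξ, 0 ≤ a → P a w → ‖ξ‖ ≤ b → a + b < ρ → ∀ x x', S.IsPass w ξ x →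
    S.IsPass w ξ x' → EqOn x x' (Icc 0 S.T)
  next : ∀ a b w ξ, 0 ≤ a → P a w → ‖ξ‖ ≤ b → a + b < ρ → ∀ x, S.IsPass w ξ x →
    P (q * a + K * b) (fun t => S.g (x t) (w t) t)

/-- The barrier argument needs a positive height `c` with `a ≤ κ c`. Heights `b + a/κ + ε` qualify,
and they still fit in the tube for small `ε`; then `ε → 0`. Nothing is assumed about `x` staying in
the tube. -/
theorem IsPass.norm_le_of_tubeBound {S : DRP E F} {r K M q κ a b : ℝ} {N : ℝ → F → ℝ}
    (hK : 0 ≤ K) (hκ : 1 ≤ κ) (hN : ∀ t ∈ Icc 0 S.T, S.TubeBound r K M q (N t) t)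
    {w : ℝ → F} {ξ : E} {x : ℝ → E} (ha : 0 ≤ a) (hξ : ‖ξ‖ ≤ b)
    (hw : ∀ t ∈ Icc 0 S.T, N t (w t) ≤ a * Real.exp ((K + K * κ + 1) * t))
    (hwr : ∀ t ∈ Icc 0 S.T, ‖w t‖ ≤ r)
    (hab : (a + b) * Real.exp ((K + K * κ + 1) * S.T) < r) (hx : S.IsPass w ξ x) :
    ∀ t ∈ Icc 0 S.T, ‖x t‖ ≤ (b + a / κ) * Real.exp ((K + K * κ + 1) * t) := by
  intro t ht
  set α := K + K * κ + 1 with hα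
  have hb : 0 ≤ b := (norm_nonneg ξ).trans hξ
  have haκ : a / κ ≤ a := div_le_self ha hκ
  have haκ0 : 0 ≤ a / κ := by positivity
  have hET := Real.exp_pos (α * S.T)
  have hEt := Real.exp_pos (α * t)
  refine le_of_forall_pos_le_add fun δ hδ => ?_
  set ε := min (δ / Real.exp (α * t)) ((r - (a + b) * Real.exp (α * S.T)) / Real.exp (α * S.T))
    with hε
  have hε0 : 0 < ε := lt_min (by positivity) (div_pos (by linarith) hET)
  have h1 : ε * Real.exp (α * t) ≤ δ := (le_div_iff₀ hEt).1 (min_le_left _ _)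
  have h2 : ε * Real.exp (α * S.T) ≤ r - (a + b) * Real.exp (α * S.T) :=
    (le_div_iff₀ hET).1 (min_le_right _ _)
  have h3 := norm_le_mul_exp_of_hasDerivWithinAt (v := fun t χ => S.f χ (w t) t) (x := x)
    (T := S.T) (r := r) (K := K) (κ := κ) (a := a) (c := b + a / κ + ε) hK (by linarith)
    (by positivity)
    (fun t ht χ hχ => ((hN t ht).f_le χ (w t) hχ (hwr t ht)).trans (by
      gcongr
      exact ((hN t ht).norm_le _).trans (hw t ht)))
    (by
      have : κ * (a / κ) = a := by field_simp
      nlinarith)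
    (by
      have : (a / κ) * Real.exp (α * S.T) ≤ a * Real.exp (α * S.T) := by gcongr
      rw [← hα]
      linarith)
    hx.2 (by rw [hx.1]; linarith) t ht
  rw [← hα] at h3
  linarith

theorem exists_passContraction [CompleteSpace E] {S : DRP E F} (hS : S.StableLinearization) :
    ∃ (P : ℝ → (ℝ → F) → Prop) (ρ H q K M : ℝ), 0 < ρ ∧ 1 ≤ H ∧ 0 ≤ q ∧ q < 1 ∧ 0 ≤ K ∧ 1 ≤ M ∧
      S.PassContraction P ρ H q K M := by
  obtain ⟨r, K, M, q, hr, hK, hM, hq0, hq1, N, hN⟩ := hS.exists_tubeBound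
  have hT := hS.T_nonneg
  -- Chosen so that `K/κ ≤ (1 - q)/2`: the feedback of the old profile through the state uses at
  -- most half of the contraction margin.
  set κ : ℝ := 2 * K / (1 - q) + 1 with hκ
  have h1q : 0 < 1 - q := by linarith
  have hκ1 : 1 ≤ κ := by
    have : 0 ≤ 2 * K / (1 - q) := by positivity
    linarith
  have hKκ : K ≤ (1 - q) / 2 * κ := by
    have : (1 - q) / 2 * κ = K + (1 - q) / 2 := by rw [hκ]; field_simp
    linarith
  set α := K + K * κ + 1 with hα
  have hα0 : 0 ≤ α := by positivity
  set H := Real.exp (α * S.T) with hH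
  have hH0 : 0 < H := Real.exp_pos _
  have hexp : ∀ t ∈ Icc 0 S.T, Real.exp (α * t) ≤ H := fun t ht =>
    Real.exp_le_exp.2 (by nlinarith [ht.2])
  have hexp1 : ∀ t ∈ Icc 0 S.T, 1 ≤ Real.exp (α * t) := fun t ht =>
    Real.one_le_exp (mul_nonneg hα0 ht.1)
  let P : ℝ → (ℝ → F) → Prop := fun a w => ContDiffOn ℝ 1 w (Icc 0 S.T) ∧
    ∀ t ∈ Icc 0 S.T, N t (w t) ≤ a * Real.exp (α * t)
  have hPa : ∀ a w, P a w → 0 ≤ a := fun a w h => by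
    have := (norm_nonneg _).trans (((hN 0 ⟨le_rfl, hT⟩).norm_le _).trans (h.2 0 ⟨le_rfl, hT⟩))
    simpa using this
  have hPn : ∀ a w, P a w → ∀ t ∈ Icc 0 S.T, ‖w t‖ ≤ H * a := fun a w h t ht => by
    have h1 := ((hN t ht).norm_le _).trans (h.2 t ht)
    have h2 := mul_le_mul_of_nonneg_left (hexp t ht) (hPa a w h)
    linarith
  have hsmall : ∀ a b : ℝ, a + b < r / H → (a + b) * H < r := fun a b h => (lt_div_iff₀ hH0).1 h
  have hwr : ∀ a b w, P a w → 0 ≤ b → a + b < r / H → ∀ t ∈ Icc 0 S.T, ‖w t‖ ≤ r :=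
    fun a b w h hb hab t ht => by
      have h1 := hPn a w h t ht
      have h2 := hsmall a b hab
      nlinarith
  have hxb : ∀ a b w ξ, 0 ≤ a → P a w → ‖ξ‖ ≤ b → a + b < r / H → ∀ x, S.IsPass w ξ x →
      ∀ t ∈ Icc 0 S.T, ‖x t‖ ≤ (b + a / κ) * Real.exp (α * t) :=
    fun a b w ξ ha h hξ hab x hx => hx.norm_le_of_tubeBound hK hκ1 hN ha hξ h.2
      (hwr a b w h ((norm_nonneg _).trans hξ) hab) (hsmall a b hab)
  have hxr : ∀ a b w ξ, 0 ≤ a → P a w → ‖ξ‖ ≤ b → a + b < r / H → ∀ x, S.IsPass w ξ x →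
      ∀ t ∈ Icc 0 S.T, ‖x t‖ ≤ r := fun a b w ξ ha h hξ hab x hx t ht => by
    have hb := (norm_nonneg ξ).trans hξ
    calc ‖x t‖ ≤ (b + a / κ) * Real.exp (α * t) := hxb a b w ξ ha h hξ hab x hx t ht
      _ ≤ (b + a) * H := by
        gcongr
        · exact div_le_self ha hκ1
        · exact hexp t ht
      _ ≤ r := by rw [add_comm b a]; exact (hsmall a b hab).le
  refine ⟨P, r / H, H, (1 + q) / 2, K, M, by positivity, Real.one_le_exp (by positivity),
    by linarith, by linarith, hK, hM, fun a w h => h.1, hPn, ?_, ?_, ?_, ?_, ?_, ?_⟩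
  · intro s w hw hs hws
    refine ⟨hw, fun t ht => ((hN t ht).le_norm _).trans ?_⟩
    have h1 := hexp1 t ht
    have h2 := hws t ht
    have h3 : M * ‖w t‖ ≤ M * s := by gcongr
    have h4 : 0 ≤ M * s := by positivity
    nlinarith
  · exact fun a a' w h haa => ⟨h.1, fun t ht => (h.2 t ht).trans (by gcongr)⟩
  · exact fun a w w' h hw => ⟨h.1.congr hw, fun t ht => by rw [hw ht]; exact h.2 t ht⟩
  · intro a b w ξ ha h hξ hab
    have hb := (norm_nonneg ξ).trans hξ
    have hwr' := hwr a b w h hb hab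
    -- The highest barrier that stays within the tube up to time `T`.
    set c := r / H with hc
    have hcH : c * H = r := by rw [hc]; field_simp
    refine exists_solution_of_tube (v := fun t χ => S.f χ (w t) t) (r := r) (K := K) (κ := κ)
      (a := a) (c := c) hT hK (by linarith) (by positivity) ha
      (fun t ht χ hχ => ((hN t ht).f_le χ (w t) hχ (hwr' t ht)).trans (by
        gcongr
        exact ((hN t ht).norm_le _).trans (h.2 t ht)))
      (fun t ht χ χ' hχ hχ' => (hN t ht).lip χ χ' (w t) hχ hχ' (hwr' t ht)) ?_
      (by nlinarith) hcH.le (by linarith)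
    intro χ hχ t ht
    exact ((hN t ht).contDiff_f χ (w t) hχ (hwr' t ht)).continuousWithinAt.comp
      (f := fun t => (χ, w t, t))
      (continuousWithinAt_const.prodMk
        ((h.1.continuousOn t ht).prodMk continuousWithinAt_id)) fun s hs => hs
  · intro a b w ξ ha h hξ hab x x' hx hx'
    have hb := (norm_nonneg ξ).trans hξ
    exact eqOn_of_tube (v := fun t χ => S.f χ (w t) t) hK
      (fun t ht χ χ' hχ hχ' => (hN t ht).lip χ χ' (w t) hχ hχ' (hwr a b w h hb hab t ht))
      hx.2 hx'.2 (hxr a b w ξ ha h hξ hab x hx) (hxr a b w ξ ha h hξ hab x' hx')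
      (hx.1.trans hx'.1.symm)
  · intro a b w ξ ha h hξ hab x hx
    have hb := (norm_nonneg ξ).trans hξ
    have hwr' := hwr a b w h hb hab
    have hxr' := hxr a b w ξ ha h hξ hab x hx
    have hxc : ContDiffOn ℝ 1 x (Icc 0 S.T) := by
      refine contDiffOn_one_Icc_of_hasDerivWithinAt hx.2 fun t ht => ?_
      exact ((hN t ht).contDiff_f (x t) (w t) (hxr' t ht)
        (hwr' t ht)).continuousWithinAt.comp (f := fun t => (x t, w t, t))
        ((hx.2 t ht).continuousWithinAt.prodMk
          ((h.1.continuousOn t ht).prodMk continuousWithinAt_id)) fun s hs => hs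
    refine ⟨fun t ht => ?_, fun t ht => ?_⟩
    · exact ((hN t ht).contDiff_g (x t) (w t) (hxr' t ht) (hwr' t ht)).comp t
        (f := fun t => (x t, w t, t))
        ((hxc t ht).prodMk ((h.1 t ht).prodMk contDiffWithinAt_id)) fun s hs => hs
    · have h1 := (hN t ht).g_le (x t) (w t) (hxr' t ht) (hwr' t ht)
      have h2 := hxb a b w ξ ha h hξ hab x hx t ht
      have h3 := h.2 t ht
      have h4 : K * (a / κ) ≤ (1 - q) / 2 * a := by
        rw [← mul_div_assoc, div_le_iff₀ (by linarith)]
        nlinarith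
      calc N t (S.g (x t) (w t) t) ≤ q * N t (w t) + K * ‖x t‖ := h1
        _ ≤ q * (a * Real.exp (α * t)) + K * ((b + a / κ) * Real.exp (α * t)) := by gcongr
        _ = (q * a + K * b + K * (a / κ)) * Real.exp (α * t) := by ring
        _ ≤ ((1 + q) / 2 * a + K * b) * Real.exp (α * t) := by
          exact mul_le_mul_of_nonneg_right (by linarith) (Real.exp_pos _).le

/-- The sequence `a` is a scalar majorant of the profile sizes; as long as `a k + b k < ρ`, each
pass can be solved and the next profile obeys the majorant. -/
theorem PassContraction.exists_isSolution {S : DRP E F} {P : ℝ → (ℝ → F) → Prop}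
    {ρ H q K M : ℝ} (h : S.PassContraction P ρ H q K M) {a b : ℕ → ℝ} {y₀ : ℝ → F} {ξ : ℕ → E}
    (ha : ∀ k, 0 ≤ a k) (hξ : ∀ k, ‖ξ k‖ ≤ b k) (hab : ∀ k, a k + b k < ρ)
    (hrec : ∀ k, q * a k + K * b k ≤ a (k + 1)) (h0 : P (a 0) y₀) :
    ∃ x y, S.IsSolution y₀ ξ x y := by
  -- Choosing a state for every profile, admissible or not, lets the profiles be defined by
  -- recursion before their sizes are known.
  have hex : ∀ k w, ∃ x, P (a k) w → S.IsPass w (ξ k) x := fun k w => by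
    by_cases hw : P (a k) w
    · obtain ⟨x, hx⟩ := h.exists_isPass _ _ w (ξ k) (ha k) hw (hξ k) (hab k)
      exact ⟨x, fun _ => hx⟩
    · exact ⟨0, fun h' => absurd h' hw⟩
  choose X hX using hex
  let y : ℕ → ℝ → F := fun k =>
    Nat.rec y₀ (fun k w t => S.g (X k w t) (w t) t) k
  have hy : ∀ k, P (a k) (y k) := by
    intro k
    induction k with
    | zero => exact h0
    | succ k ih =>
      exact h.mono _ _ _ (h.next _ _ _ _ (ha k) ih (hξ k) (hab k) _ (hX k _ ih)) (hrec k)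
  -- State `k + 1` is driven by profile `k`; truncated subtraction gives state `0` an irrelevant
  -- value.
  refine ⟨fun k => X (k - 1) (y (k - 1)), y, ⟨fun k => h.contDiffOn _ _ (hy k), ?_⟩,
    fun t _ => rfl, fun k => (hX k _ (hy k)).1⟩
  exact fun k t ht => ⟨(hX k _ (hy k)).2 t ht, rfl⟩

theorem PassContraction.isSolution_bound {S : DRP E F} {P : ℝ → (ℝ → F) → Prop}
    {ρ H q K M : ℝ} (h : S.PassContraction P ρ H q K M) {a b : ℕ → ℝ} {y₀ : ℝ → F} {ξ : ℕ → E}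
    (ha : ∀ k, 0 ≤ a k) (hξ : ∀ k, ‖ξ k‖ ≤ b k) (hab : ∀ k, a k + b k < ρ)
    (hrec : ∀ k, q * a k + K * b k ≤ a (k + 1)) (h0 : P (a 0) y₀)
    {x : ℕ → ℝ → E} {y : ℕ → ℝ → F} (hs : S.IsSolution y₀ ξ x y) (k : ℕ) : P (a k) (y k) := by
  induction k with
  | zero => exact h.congr _ _ _ h0 hs.2.1
  | succ k ih =>
    have hx : S.IsPass (y k) (ξ k) (x (k + 1)) := ⟨hs.2.2 k, fun t ht => (hs.1.2 k t ht).1⟩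
    exact h.congr _ _ _
      (h.mono _ _ _ (h.next _ _ _ _ (ha k) ih (hξ k) (hab k) _ hx) (hrec k))
      fun t ht => (hs.1.2 k t ht).2

theorem PassContraction.hasUniqueSolution {S : DRP E F} {P : ℝ → (ℝ → F) → Prop}
    {ρ H q K M : ℝ} (h : S.PassContraction P ρ H q K M) {a b : ℕ → ℝ} {y₀ : ℝ → F} {ξ : ℕ → E}
    (ha : ∀ k, 0 ≤ a k) (hξ : ∀ k, ‖ξ k‖ ≤ b k) (hab : ∀ k, a k + b k < ρ)
    (hrec : ∀ k, q * a k + K * b k ≤ a (k + 1)) (h0 : P (a 0) y₀) :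
    S.HasUniqueSolution y₀ ξ := by
  refine ⟨h.exists_isSolution ha hξ hab hrec h0, fun x y x' y' hs hs' => ?_⟩
  have hx : ∀ k, EqOn (y k) (y' k) (Icc 0 S.T) →
      EqOn (x (k + 1)) (x' (k + 1)) (Icc 0 S.T) := fun k hy => by
    refine h.eqOn _ _ _ _ (ha k) (h.isSolution_bound ha hξ hab hrec h0 hs k) (hξ k) (hab k) _ _
      ⟨hs.2.2 k, fun t ht => (hs.1.2 k t ht).1⟩ ?_
    exact IsPass.congr ⟨hs'.2.2 k, fun t ht => (hs'.1.2 k t ht).1⟩ hy.symm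
  have hy : ∀ k, EqOn (y k) (y' k) (Icc 0 S.T) := by
    intro k
    induction k with
    | zero => exact hs.2.1.trans hs'.2.1.symm
    | succ k ih =>
      intro t ht
      rw [(hs.1.2 k t ht).2, (hs'.1.2 k t ht).2, hx k ih ht, ih ht]
  exact fun k => ⟨hx k (hy k), hy k⟩

end DRP

/-! ### From extended norms to real bounds, and a scalar recursion. -/

section Norms

variable {F : Type*} [NormedAddCommGroup F]

theorem passNorm_le_ofReal {T c : ℝ} {w : ℝ → F} (h : ∀ t ∈ Icc 0 T, ‖w t‖ ≤ c) :
    passNorm T w ≤ ENNReal.ofReal c :=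
  iSup₂_le fun t ht => by
    rw [← ofReal_norm]
    exact ENNReal.ofReal_le_ofReal (h t ht)

theorem norm_le_of_passNorm_le {T s : ℝ} {w : ℝ → F} (hs : 0 ≤ s)
    (h : passNorm T w ≤ ENNReal.ofReal s) {t : ℝ} (ht : t ∈ Icc 0 T) : ‖w t‖ ≤ s := by
  have h1 : ‖w t‖ₑ ≤ passNorm T w := le_iSup₂ (f := fun t (_ : t ∈ Icc 0 T) => ‖w t‖ₑ) t ht
  rw [← ofReal_norm] at h1
  exact (ENNReal.ofReal_le_ofReal_iff hs).1 (h1.trans h)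

theorem norm_le_of_expNorm_le {r s : ℝ} {b : ℕ → F} (hr : 0 < r) (hs : 0 ≤ s)
    (h : expNorm r b ≤ ENNReal.ofReal s) (k : ℕ) : ‖b k‖ ≤ r ^ k * s := by
  have h1 : ENNReal.ofReal (r⁻¹ ^ k) * ‖b k‖ₑ ≤ expNorm r b :=
    le_iSup (fun k : ℕ => ENNReal.ofReal (r⁻¹ ^ k) * ‖b k‖ₑ) k
  rw [← ofReal_norm, ← ENNReal.ofReal_mul (by positivity)] at h1
  have h2 := (ENNReal.ofReal_le_ofReal_iff hs).1 (h1.trans h)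
  rwa [inv_pow, inv_mul_le_iff₀ (by positivity)] at h2

/-- Smallness forces the extended norms to be finite, so a single real `s` measures the boundary
data. -/
theorem exists_size_of_lt {E : Type*} [NormedAddCommGroup E] {T r δ : ℝ} {w : ℝ → F} {ξ : ℕ → E}
    (hr : 0 < r) (h : passNorm T w + expNorm r ξ < ENNReal.ofReal δ) :
    ∃ s, 0 ≤ s ∧ s < δ ∧ passNorm T w + expNorm r ξ = ENNReal.ofReal s ∧
      (∀ t ∈ Icc 0 T, ‖w t‖ ≤ s) ∧ ∀ k, ‖ξ k‖ ≤ r ^ k * s := by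
  have htop : passNorm T w + expNorm r ξ ≠ ⊤ := (h.trans ENNReal.ofReal_lt_top).ne
  have he := (ENNReal.ofReal_toReal htop).symm
  set s := (passNorm T w + expNorm r ξ).toReal with hs
  have hs0 : 0 ≤ s := ENNReal.toReal_nonneg
  refine ⟨s, hs0, ?_, he, fun t ht => ?_, fun k => ?_⟩
  · rw [he] at h
    exact (ENNReal.ofReal_lt_ofReal_iff_of_nonneg hs0).1 h
  · exact norm_le_of_passNorm_le hs0 (he ▸ le_self_add) ht
  · exact norm_le_of_expNorm_le hr hs0 (he ▸ le_add_self) k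

end Norms

/-- A stable scalar recursion with vanishing input tends to zero. -/
theorem tendsto_zero_of_recursion {a b : ℕ → ℝ} {q : ℝ} (hq0 : 0 ≤ q) (hq1 : q < 1)
    (ha : ∀ k, 0 ≤ a k) (hab : ∀ k, a (k + 1) ≤ q * a k + b k) (hb : Tendsto b atTop (𝓝 0)) :
    Tendsto a atTop (𝓝 0) := by
  rw [Metric.tendsto_atTop]
  intro ε hε
  have h1 : 0 < (1 - q) * (ε / 2) := mul_pos (by linarith) (by positivity)
  obtain ⟨k₀, hk₀⟩ := eventually_atTop.1 (hb.eventually (gt_mem_nhds h1))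
  have h2 : ∀ j, a (k₀ + j) ≤ q ^ j * a k₀ + ε / 2 := by
    intro j
    induction j with
    | zero => simpa using by linarith
    | succ j ih =>
      have h3 := hab (k₀ + j)
      have h4 := hk₀ (k₀ + j) (by omega)
      have h5 := mul_le_mul_of_nonneg_left ih hq0
      rw [← add_assoc, pow_succ]
      linarith
  have h3 : Tendsto (fun j => q ^ j * a k₀) atTop (𝓝 0) := by
    simpa using (tendsto_pow_atTop_nhds_zero_of_lt_one hq0 hq1).mul_const (a k₀)
  obtain ⟨j₀, hj₀⟩ := eventually_atTop.1 (h3.eventually (gt_mem_nhds (half_pos hε)))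
  refine ⟨k₀ + j₀, fun k hk => ?_⟩
  obtain ⟨j, rfl⟩ := Nat.exists_eq_add_of_le (show k₀ ≤ k by omega)
  rw [Real.dist_eq, sub_zero, abs_of_nonneg (ha _)]
  linarith [h2 j, hj₀ j (by omega)]

/-! ### The three stability properties from scalar majorants. -/

namespace DRP

variable {E F : Type*} [NormedAddCommGroup E] [NormedSpace ℝ E]
  [NormedAddCommGroup F] [NormedSpace ℝ F]
  {S : DRP E F} {P : ℝ → (ℝ → F) → Prop} {ρ H q K M : ℝ}

theorem PassContraction.lyapunovStable (h : S.PassContraction P ρ H q K M) (hρ : 0 < ρ)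
    (hH : 1 ≤ H) (hq1 : q < 1) (hK : 0 ≤ K) (hM : 1 ≤ M) : S.LyapunovStable := by
  intro ε hε
  have h1q : 0 < 1 - q := by linarith
  -- The constant sequence `C * s` is a majorant: `C ≥ M` covers the initial profile and `q * C + K
  -- ≤ C` the recursion.
  set C := M + K / (1 - q) with hC
  have hKC : K ≤ (1 - q) * C := by
    have : (1 - q) * C = (1 - q) * M + K := by rw [hC]; field_simp
    nlinarith
  have hMC : M ≤ C := by
    have : 0 ≤ K / (1 - q) := by positivity
    linarith
  have hC1 : 1 ≤ C := hM.trans hMC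
  have hHC : 1 ≤ H * C := one_le_mul_of_one_le_of_one_le hH hC1
  -- The first bound gives `H * C * s < ε`, its factor 2 gives `δ < ε`, and the second keeps `C * s
  -- + s` below `ρ`.
  refine ⟨min (ε / (2 * (H * C))) (ρ / (C + 1)), lt_min (by positivity) (by positivity), ?_, ?_⟩
  · refine (min_le_left _ _).trans_lt ?_
    rw [div_lt_iff₀ (by positivity)]
    nlinarith
  intro y₀ ξ hy₀ hδ
  obtain ⟨s, hs0, hsδ, -, hws, hξs⟩ := exists_size_of_lt one_pos hδ
  have hs1 : s * (2 * (H * C)) < ε := (lt_div_iff₀ (by positivity)).1 (hsδ.trans_le (min_le_left _ _))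
  have hs2 : s * (C + 1) < ρ := (lt_div_iff₀ (by positivity)).1 (hsδ.trans_le (min_le_right _ _))
  have ha : ∀ k : ℕ, 0 ≤ (fun _ : ℕ => C * s) k := fun _ => by positivity
  have hb : ∀ k, ‖ξ k‖ ≤ (fun _ : ℕ => s) k := fun k => by simpa using hξs k
  have hab : ∀ k : ℕ, (fun _ : ℕ => C * s) k + (fun _ : ℕ => s) k < ρ := fun _ => by
    simp only; linarith
  have hrec : ∀ k : ℕ, q * (fun _ : ℕ => C * s) k + K * (fun _ : ℕ => s) k ≤
      (fun _ : ℕ => C * s) (k + 1) := fun _ => by simp only; nlinarith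
  have h0 : P ((fun _ : ℕ => C * s) 0) y₀ :=
    h.mono _ _ _ (h.of_norm_le s y₀ hy₀ hs0 hws) (by simp only; gcongr)
  refine ⟨h.hasUniqueSolution ha hb hab hrec h0, fun x y hsol k => ?_⟩
  have hP := h.isSolution_bound ha hb hab hrec h0 hsol k
  refine (passNorm_le_ofReal (h.norm_le _ _ hP)).trans_lt ?_
  refine (ENNReal.ofReal_lt_ofReal_iff hε).2 ?_
  have : 0 ≤ H * C * s := by positivity
  linarith

theorem PassContraction.asymptoticallyStable (h : S.PassContraction P ρ H q K M) (hρ : 0 < ρ)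
    (hH : 1 ≤ H) (hq0 : 0 ≤ q) (hq1 : q < 1) (hK : 0 ≤ K) (hM : 1 ≤ M) :
    S.AsymptoticallyStable := by
  refine ⟨h.lyapunovStable hρ hH hq1 hK hM, ?_⟩
  have h1q : 0 < 1 - q := by linarith
  set C := M + K / (1 - q) with hC
  have hKC : K ≤ (1 - q) * C := by
    have : (1 - q) * C = (1 - q) * M + K := by rw [hC]; field_simp
    nlinarith
  have hMC : M ≤ C := by
    have : 0 ≤ K / (1 - q) := by positivity
    linarith
  have hC1 : 1 ≤ C := hM.trans hMC
  refine ⟨ρ / (C + 1), by positivity, fun y₀ ξ hy₀ hδ hξ0 => ?_⟩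
  obtain ⟨s, hs0, hsδ, -, hws, hξs⟩ := exists_size_of_lt one_pos hδ
  have hs2 : s * (C + 1) < ρ := (lt_div_iff₀ (by positivity)).1 hsδ
  have hξs' : ∀ k, ‖ξ k‖ ≤ s := fun k => by simpa using hξs k
  -- The exact recursion sees the decay of `‖ξ k‖`; the constant `C * s` only keeps it in the
  -- admissible range.
  let a : ℕ → ℝ := fun k => Nat.rec (M * s) (fun k v => q * v + K * ‖ξ k‖) k
  have hsucc : ∀ k, a (k + 1) = q * a k + K * ‖ξ k‖ := fun k => rfl
  have ha : ∀ k, 0 ≤ a k := by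
    intro k
    induction k with
    | zero => exact mul_nonneg (by linarith) hs0
    | succ k ih => rw [hsucc]; positivity
  have haC : ∀ k, a k ≤ C * s := by
    intro k
    induction k with
    | zero => exact mul_le_mul_of_nonneg_right hMC hs0
    | succ k ih =>
      rw [hsucc]
      have h1 := mul_le_mul_of_nonneg_left ih hq0
      have h2 := mul_le_mul_of_nonneg_left (hξs' k) hK
      nlinarith
  have hab : ∀ k, a k + ‖ξ k‖ < ρ := fun k => by linarith [haC k, hξs' k]
  have hrec : ∀ k, q * a k + K * ‖ξ k‖ ≤ a (k + 1) := fun k => le_rfl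
  have h0 : P (a 0) y₀ := h.of_norm_le s y₀ hy₀ hs0 hws
  refine ⟨h.hasUniqueSolution ha (fun _ => le_rfl) hab hrec h0, fun x y hsol => ?_⟩
  have hlim : Tendsto a atTop (𝓝 0) :=
    tendsto_zero_of_recursion hq0 hq1 ha (fun k => le_rfl)
      (by simpa using hξ0.norm.const_mul K)
  have hlim' : Tendsto (fun k => ENNReal.ofReal (H * a k)) atTop (𝓝 0) := by
    simpa using ENNReal.tendsto_ofReal (hlim.const_mul H)
  exact tendsto_of_tendsto_of_tendsto_of_le_of_le tendsto_const_nhds hlim' (fun _ => zero_le)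
    fun k => passNorm_le_ofReal (h.norm_le _ _
      (h.isSolution_bound ha (fun _ => le_rfl) hab hrec h0 hsol k))

theorem PassContraction.exponentiallyStable (h : S.PassContraction P ρ H q K M) (hρ : 0 < ρ)
    (hH : 1 ≤ H) (hq0 : 0 ≤ q) (hq1 : q < 1) (hK : 0 ≤ K) (hM : 1 ≤ M) :
    S.ExponentiallyStable := by
  refine ⟨h.asymptoticallyStable hρ hH hq0 hq1 hK hM, ?_⟩
  have h1q : 0 < 1 - q := by linarith
  -- A rate strictly above `q` leaves room to absorb inputs decaying at the same rate as the
  -- majorant.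
  set q' := (1 + q) / 2 with hq'
  have hq'1 : q' < 1 := by linarith
  have hq'0 : 0 < q' := by linarith
  have hd : 0 < q' - q := by linarith
  set C := M + K / (q' - q) with hC
  have hKC : K ≤ (q' - q) * C := by
    have : (q' - q) * C = (q' - q) * M + K := by rw [hC]; field_simp
    nlinarith
  have hMC : M ≤ C := by
    have : 0 ≤ K / (q' - q) := by positivity
    linarith
  have hC1 : 1 ≤ C := hM.trans hMC
  have hHC : 1 ≤ H * C := one_le_mul_of_one_le_of_one_le hH hC1
  -- The rate dominates both `q'` and `r` and is below 1, so `C * γ ^ k * s` is a majorant and the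
  -- radius is independent of `r`. The summand `r` in the first function only secures strict
  -- monotonicity.
  refine ⟨ρ / (C + 1), fun r => H * C + r, fun r => q' + (1 - q') * r, by positivity,
    by fun_prop, ?_, ?_, by fun_prop, ?_, ?_, ?_⟩
  · exact fun r _ r' _ hr => by simpa using hr
  · exact fun r hr => by
      have := hr.1
      simp only [mem_Ici]; linarith
  · exact fun r _ r' _ hr => by
      simp only
      nlinarith
  · rintro r ⟨hr0, hr1⟩
    constructor <;> nlinarith
  rintro r ⟨hr0, hr1⟩ y₀ ξ hy₀ hδ
  obtain ⟨s, hs0, hsδ, hs, hws, hξs⟩ := exists_size_of_lt hr0 hδ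
  have hs2 : s * (C + 1) < ρ := (lt_div_iff₀ (by positivity)).1 hsδ
  set γ := q' + (1 - q') * r with hγ
  have hγ' : q' ≤ γ := by nlinarith
  have hγr : r ≤ γ := by nlinarith
  have hγ1 : γ ≤ 1 := by nlinarith
  have hγ0 : 0 < γ := hq'0.trans_le hγ'
  set a : ℕ → ℝ := fun k => C * γ ^ k * s with ha'
  set b : ℕ → ℝ := fun k => γ ^ k * s with hb'
  have ha : ∀ k, 0 ≤ a k := fun k => by positivity
  have hb : ∀ k, ‖ξ k‖ ≤ b k := fun k => (hξs k).trans (by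
    simp only [hb']
    gcongr)
  have hab : ∀ k, a k + b k < ρ := fun k => by
    have h1 : γ ^ k ≤ 1 := pow_le_one₀ hγ0.le hγ1
    have h2 : a k + b k = γ ^ k * (s * (C + 1)) := by simp only [ha', hb']; ring
    have h3 : 0 ≤ s * (C + 1) := by positivity
    nlinarith
  have hrec : ∀ k, q * a k + K * b k ≤ a (k + 1) := fun k => by
    have h1 : 0 ≤ γ ^ k * s := by positivity
    have h2 : q * C + K ≤ C * γ := by nlinarith
    calc q * a k + K * b k = (q * C + K) * (γ ^ k * s) := by simp only [ha', hb']; ring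
      _ ≤ (C * γ) * (γ ^ k * s) := by gcongr
      _ = a (k + 1) := by simp only [ha']; ring
  have h0 : P (a 0) y₀ :=
    h.mono _ _ _ (h.of_norm_le s y₀ hy₀ hs0 hws) (by simp only [ha', pow_zero, mul_one]; gcongr)
  refine ⟨h.hasUniqueSolution ha hb hab hrec h0, fun x y hsol k => ?_⟩
  have hP := h.isSolution_bound ha hb hab hrec h0 hsol k
  rw [hs, ← ENNReal.ofReal_mul (by positivity)]
  refine (passNorm_le_ofReal (h.norm_le _ _ hP)).trans (ENNReal.ofReal_le_ofReal ?_)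
  have h1 : 0 ≤ r * (γ ^ k * s) := by positivity
  have h2 : H * a k = H * C * γ ^ k * s := by simp only [ha']; ring
  rw [h2]
  nlinarith

theorem StableLinearization.exponentiallyStable [CompleteSpace E]
    (hS : S.StableLinearization) : S.ExponentiallyStable := by
  obtain ⟨P, ρ, H, q, K, M, hρ, hH, hq0, hq1, hK, hM, h⟩ := exists_passContraction hS
  exact h.exponentiallyStable hρ hH hq0 hq1 hK hM

end DRP

/-! ### Spectral radii and powers of matrices. -/

section MatrixRadius

variable {ι κ : Type*} [Fintype ι] [DecidableEq ι] [Fintype κ] [DecidableEq κ]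

/-- The characteristic polynomials of `A * B` and `B * A` agree up to powers of `X`, which do not
vanish at `z ≠ 0`. -/
theorem Matrix.mem_spectrum_mul_comm_of_ne_zero (A : Matrix ι κ ℂ) (B : Matrix κ ι ℂ) {z : ℂ}
    (hz : z ≠ 0) (h : z ∈ spectrum ℂ (A * B)) : z ∈ spectrum ℂ (B * A) := by
  rw [Matrix.mem_spectrum_iff_isRoot_charpoly, Polynomial.IsRoot] at h ⊢
  have e := congrArg (Polynomial.eval z) (Matrix.charpoly_mul_comm' A B)
  simpa [h, hz] using e

theorem Matrix.spectralRadius_mul_le (A : Matrix ι κ ℂ) (B : Matrix κ ι ℂ) :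
    spectralRadius ℂ (A * B) ≤ spectralRadius ℂ (B * A) := by
  refine iSup₂_le fun z hz => ?_
  rcases eq_or_ne z 0 with rfl | h0
  · simp
  · exact le_iSup₂ (f := fun (z : ℂ) (_ : z ∈ spectrum ℂ (B * A)) => ‖z‖ₑ) z
      (Matrix.mem_spectrum_mul_comm_of_ne_zero A B h0 hz)

theorem matrixRadius_mul_comm (A : Matrix ι κ ℝ) (B : Matrix κ ι ℝ) :
    matrixRadius (A * B) = matrixRadius (B * A) := by
  rw [matrixRadius, matrixRadius, Matrix.map_mul, Matrix.map_mul]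
  exact le_antisymm (Matrix.spectralRadius_mul_le _ _) (Matrix.spectralRadius_mul_le _ _)

/-- After the shift by 1 the eigenvalue 0 of the product matters, so the full spectra must agree;
for square factors the characteristic polynomials coincide. -/
theorem matrixRadius_one_add_mul_comm (A B : Matrix ι ι ℝ) :
    matrixRadius (1 + A * B) = matrixRadius (1 + B * A) := by
  have h1 : ∀ X : Matrix ι ι ℝ, (1 + X).map (algebraMap ℝ ℂ) =
      algebraMap ℂ (Matrix ι ι ℂ) 1 + X.map (algebraMap ℝ ℂ) := fun X => by
    rw [Matrix.map_add _ (map_add _), map_one, Matrix.map_one _ (map_zero _) (map_one _)]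
  have h2 : ∀ X Y : Matrix ι ι ℂ, spectrum ℂ (X * Y) = spectrum ℂ (Y * X) := fun X Y => by
    ext z
    rw [Matrix.mem_spectrum_iff_isRoot_charpoly, Matrix.mem_spectrum_iff_isRoot_charpoly,
      Matrix.charpoly_mul_comm]
  rw [matrixRadius, matrixRadius, h1, h1, Matrix.map_mul, Matrix.map_mul, spectralRadius,
    spectralRadius, ← spectrum.singleton_add_eq, ← spectrum.singleton_add_eq, h2]

-- For `c` between the spectral radius and 1, Gelfand's formula gives `‖Z ^ k‖ ≤ c ^ k` eventually,
-- and the row-sum norm dominates every entry.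
attribute [local instance] Matrix.linftyOpNormedRing Matrix.linftyOpNormedAlgebra in
theorem tendsto_pow_apply_of_matrixRadius_lt_one {M : Matrix ι ι ℝ} (hM : matrixRadius M < 1)
    (i j : ι) : Tendsto (fun k => (M ^ k) i j) atTop (𝓝 0) := by
  set Z := M.map (algebraMap ℝ ℂ) with hZ
  obtain ⟨c, hc, hc1⟩ := exists_between hM
  have hg := spectrum.pow_nnnorm_pow_one_div_tendsto_nhds_spectralRadius Z
  have hpow : Tendsto (fun k => c ^ k) atTop (𝓝 0) :=
    ENNReal.tendsto_pow_atTop_nhds_zero_of_lt_one hc1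
  have hle : ∀ᶠ k in atTop, (‖Z ^ k‖₊ : ℝ≥0∞) ≤ c ^ k := by
    filter_upwards [hg.eventually (gt_mem_nhds hc), eventually_ge_atTop 1] with k hk hk1
    have hk0 : (0 : ℝ) < k := by exact_mod_cast hk1
    have h1 := ENNReal.rpow_le_rpow hk.le hk0.le
    rwa [← ENNReal.rpow_mul, one_div_mul_cancel hk0.ne', ENNReal.rpow_one,
      ENNReal.rpow_natCast] at h1
  have hentry : ∀ k, ENNReal.ofReal |(M ^ k) i j| ≤ ‖Z ^ k‖₊ := by
    intro k
    have h1 : (Z ^ k) i j = ((M ^ k) i j : ℂ) := by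
      rw [hZ, ← Matrix.map_pow]
      rfl
    have h2 : ‖(Z ^ k) i j‖₊ ≤ ‖Z ^ k‖₊ := by
      rw [Matrix.linfty_opNNNorm_def]
      exact (Finset.single_le_sum (f := fun j => ‖(Z ^ k) i j‖₊) (fun _ _ => zero_le)
        (Finset.mem_univ j)).trans
        (Finset.le_sup (f := fun i => ∑ j, ‖(Z ^ k) i j‖₊) (Finset.mem_univ i))
    rw [h1] at h2
    have h3 : ENNReal.ofReal |(M ^ k) i j| = (‖((M ^ k) i j : ℂ)‖₊ : ℝ≥0∞) := by
      rw [← Real.norm_eq_abs, ← Complex.norm_real, ofReal_norm]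
      rfl
    rw [h3]
    exact_mod_cast h2
  have hlim : Tendsto (fun k => ENNReal.ofReal |(M ^ k) i j|) atTop (𝓝 0) :=
    tendsto_of_tendsto_of_tendsto_of_le_of_le' tendsto_const_nhds hpow
      (Eventually.of_forall fun _ => zero_le) (hle.mono fun k hk => (hentry k).trans hk)
  have h4 := (ENNReal.tendsto_toReal ENNReal.zero_ne_top).comp hlim
  refine (tendsto_zero_iff_abs_tendsto_zero _).2 (h4.congr fun k => ?_)
  simp [ENNReal.toReal_ofReal (abs_nonneg _)]

theorem tendsto_pow_of_matrixRadius_lt_one {V : Type*} [NormedAddCommGroup V] [NormedSpace ℝ V]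
    [FiniteDimensional ℝ V] (b : Module.Basis ι ℝ V) (A : V →L[ℝ] V)
    (hA : matrixRadius (LinearMap.toMatrix b b (A : V →ₗ[ℝ] V)) < 1) :
    Tendsto (fun k => A ^ k) atTop (𝓝 0) := by
  let φ : Matrix ι ι ℝ ≃ₐ[ℝ] (V →L[ℝ] V) :=
    (Matrix.toLinAlgEquiv b).trans (Module.End.toContinuousLinearMap V)
  set M := LinearMap.toMatrix b b (A : V →ₗ[ℝ] V) with hM
  have hφ : φ M = A := by
    ext v
    change Matrix.toLin b b M v = A v
    rw [hM, Matrix.toLin_toMatrix]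
    rfl
  have hlim : Tendsto (fun k => M ^ k) atTop (𝓝 0) :=
    tendsto_pi_nhds.2 fun i => tendsto_pi_nhds.2 fun j =>
      tendsto_pow_apply_of_matrixRadius_lt_one hA i j
  -- Finite dimension carries the entrywise limit over to the operator norm.
  have hc : Continuous φ.toLinearMap := LinearMap.continuous_of_finiteDimensional _
  have h := (hc.tendsto 0).comp hlim
  rw [map_zero] at h
  refine h.congr fun k => ?_
  simp [map_pow, hφ]

end MatrixRadius

/-! ### The learning scheme in deviation coordinates. -/

section LearningControl

variable {n m p : ℕ}

theorem toMatrix_fderiv_eq_jacobianMatrix {a b : ℕ}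
    (h : EuclideanSpace ℝ (Fin a) → EuclideanSpace ℝ (Fin b)) (v : EuclideanSpace ℝ (Fin a)) :
    LinearMap.toMatrix (EuclideanSpace.basisFun (Fin a) ℝ).toBasis
      (EuclideanSpace.basisFun (Fin b) ℝ).toBasis (fderiv ℝ h v).toLinearMap =
      jacobianMatrix h v := by
  ext i j
  simp [LinearMap.toMatrix_apply, jacobianMatrix]

/-- The linearized pass factors through the updated input: `(θ, v) ↦ v + L' θ`, then `u ↦ (D' u,
u)`. -/
theorem toMatrix_comp_eq_fromRows_mul_fromCols
    (D' : EuclideanSpace ℝ (Fin m) →L[ℝ] EuclideanSpace ℝ (Fin p))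
    (L' : EuclideanSpace ℝ (Fin p) →L[ℝ] EuclideanSpace ℝ (Fin m)) :
    LinearMap.toMatrix
      ((EuclideanSpace.basisFun (Fin p) ℝ).toBasis.prod (EuclideanSpace.basisFun (Fin m) ℝ).toBasis)
      ((EuclideanSpace.basisFun (Fin p) ℝ).toBasis.prod (EuclideanSpace.basisFun (Fin m) ℝ).toBasis)
      (((D'.prod (ContinuousLinearMap.id ℝ _)).comp
        (ContinuousLinearMap.snd ℝ _ _ + L'.comp (ContinuousLinearMap.fst ℝ _ _))).toLinearMap) =
    Matrix.fromRows (LinearMap.toMatrix (EuclideanSpace.basisFun (Fin m) ℝ).toBasis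
        (EuclideanSpace.basisFun (Fin p) ℝ).toBasis D'.toLinearMap)
        (1 : Matrix (Fin m) (Fin m) ℝ) *
      Matrix.fromCols (LinearMap.toMatrix (EuclideanSpace.basisFun (Fin p) ℝ).toBasis
        (EuclideanSpace.basisFun (Fin m) ℝ).toBasis L'.toLinearMap)
        (1 : Matrix (Fin m) (Fin m) ℝ) := by
  rw [ContinuousLinearMap.toLinearMap_comp, LinearMap.toMatrix_comp _
    (EuclideanSpace.basisFun (Fin m) ℝ).toBasis]
  congr 1
  · ext (i | i) j
    · simp [LinearMap.toMatrix_apply]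
    · simp [LinearMap.toMatrix_apply, Matrix.one_apply]
  · ext i (j | j)
    · simp [LinearMap.toMatrix_apply, Module.Basis.prod_apply]
    · simp [LinearMap.toMatrix_apply, Module.Basis.prod_apply, Matrix.one_apply]

variable {T : ℝ}
  {f : EuclideanSpace ℝ (Fin n) → EuclideanSpace ℝ (Fin m) → ℝ → EuclideanSpace ℝ (Fin n)}
  {g : EuclideanSpace ℝ (Fin n) → EuclideanSpace ℝ (Fin m) → ℝ → EuclideanSpace ℝ (Fin p)}
  {l : EuclideanSpace ℝ (Fin p) → ℝ → EuclideanSpace ℝ (Fin m)}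
  {xs : ℝ → EuclideanSpace ℝ (Fin n)} {us : ℝ → EuclideanSpace ℝ (Fin m)}
  {ydes : ℝ → EuclideanSpace ℝ (Fin p)}
  {O : Set (EuclideanSpace ℝ (Fin n) × EuclideanSpace ℝ (Fin m) × ℝ)}

theorem contDiffOn_reference_state (hus : ContDiffOn ℝ 1 us (Icc 0 T))
    (hxs : ∀ t ∈ Icc 0 T, HasDerivWithinAt xs (f (xs t) (us t) t) (Icc 0 T) t)
    (href : ∀ t ∈ Icc 0 T, (xs t, us t, t) ∈ O)
    (hf : ContDiffOn ℝ 1 (fun z => f z.1 z.2.1 z.2.2) (O ∩ {z | z.2.2 ∈ Icc 0 T})) :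
    ContDiffOn ℝ 1 xs (Icc 0 T) :=
  contDiffOn_one_Icc_of_hasDerivWithinAt hxs <|
    hf.continuousOn.comp (f := fun t => (xs t, us t, t))
      (ContinuousOn.prodMk (fun t ht => (hxs t ht).continuousWithinAt)
        (hus.continuousOn.prodMk continuousOn_id)) fun t ht => ⟨href t ht, ht⟩

theorem contDiffOn_along_reference {G : Type*} [NormedAddCommGroup G] [NormedSpace ℝ G]
    {h : EuclideanSpace ℝ (Fin n) → EuclideanSpace ℝ (Fin m) → ℝ → G}
    (hus : ContDiffOn ℝ 1 us (Icc 0 T)) (hxs : ContDiffOn ℝ 1 xs (Icc 0 T))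
    (href : ∀ t ∈ Icc 0 T, (xs t, us t, t) ∈ O)
    (hh : ContDiffOn ℝ 1 (fun z => h z.1 z.2.1 z.2.2) (O ∩ {z | z.2.2 ∈ Icc 0 T})) :
    ContDiffOn ℝ 1 (fun t => h (xs t) (us t) t) (Icc 0 T) :=
  hh.comp (f := fun t => (xs t, us t, t)) (hxs.prodMk (hus.prodMk contDiffOn_id))
    fun t ht => ⟨href t ht, ht⟩

/-- A `C^1` function of state, input and time is `C^1` in the deviation coordinates. -/
theorem contDiffWithinAt_deviation {G : Type*} [NormedAddCommGroup G] [NormedSpace ℝ G]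
    {h : EuclideanSpace ℝ (Fin n) → EuclideanSpace ℝ (Fin m) → ℝ → G}
    (hus : ContDiffOn ℝ 1 us (Icc 0 T)) (hxs : ContDiffOn ℝ 1 xs (Icc 0 T)) (hO : IsOpen O)
    (href : ∀ t ∈ Icc 0 T, (xs t, us t, t) ∈ O)
    (hh : ContDiffOn ℝ 1 (fun z => h z.1 z.2.1 z.2.2) (O ∩ {z | z.2.2 ∈ Icc 0 T}))
    (hl : ContDiffOn ℝ 1 (fun z : EuclideanSpace ℝ (Fin p) × ℝ => l z.1 z.2)
      (univ ×ˢ Icc 0 T))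
    (hl0 : ∀ t ∈ Icc 0 T, l 0 t = 0) {t : ℝ} (ht : t ∈ Icc 0 T) :
    ContDiffWithinAt ℝ 1
      (fun z : EuclideanSpace ℝ (Fin n) ×
          (EuclideanSpace ℝ (Fin p) × EuclideanSpace ℝ (Fin m)) × ℝ =>
        h (z.1 + xs z.2.2) (z.2.1.2 + us z.2.2 + l z.2.1.1 z.2.2) z.2.2)
      (DRP.passSlab _ _ T) (0, 0, t) := by
  set Z := DRP.passSlab (EuclideanSpace ℝ (Fin n))
    (EuclideanSpace ℝ (Fin p) × EuclideanSpace ℝ (Fin m)) T with hZ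
  have ht2 : ContDiffOn ℝ 1 (fun z : EuclideanSpace ℝ (Fin n) ×
      (EuclideanSpace ℝ (Fin p) × EuclideanSpace ℝ (Fin m)) × ℝ => z.2.2) Z := by fun_prop
  have hx : ContDiffOn ℝ 1 (fun z : EuclideanSpace ℝ (Fin n) ×
      (EuclideanSpace ℝ (Fin p) × EuclideanSpace ℝ (Fin m)) × ℝ => xs z.2.2) Z :=
    hxs.comp ht2 fun z hz => hz
  have hu : ContDiffOn ℝ 1 (fun z : EuclideanSpace ℝ (Fin n) ×
      (EuclideanSpace ℝ (Fin p) × EuclideanSpace ℝ (Fin m)) × ℝ => us z.2.2) Z :=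
    hus.comp ht2 fun z hz => hz
  have hl' : ContDiffOn ℝ 1 (fun z : EuclideanSpace ℝ (Fin n) ×
      (EuclideanSpace ℝ (Fin p) × EuclideanSpace ℝ (Fin m)) × ℝ => l z.2.1.1 z.2.2) Z :=
    hl.comp (f := fun z : EuclideanSpace ℝ (Fin n) ×
      (EuclideanSpace ℝ (Fin p) × EuclideanSpace ℝ (Fin m)) × ℝ => (z.2.1.1, z.2.2))
      (by fun_prop) fun z hz => ⟨mem_univ _, hz⟩
  have h1 : ContDiffOn ℝ 1 (fun z : EuclideanSpace ℝ (Fin n) ×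
      (EuclideanSpace ℝ (Fin p) × EuclideanSpace ℝ (Fin m)) × ℝ => z.1) Z := by fun_prop
  have h2 : ContDiffOn ℝ 1 (fun z : EuclideanSpace ℝ (Fin n) ×
      (EuclideanSpace ℝ (Fin p) × EuclideanSpace ℝ (Fin m)) × ℝ => z.2.1.2) Z := by fun_prop
  have hφ := (h1.add hx).prodMk (((h2.add hu).add hl').prodMk ht2)
  have hz : ((0 : EuclideanSpace ℝ (Fin n)),
      (0 : EuclideanSpace ℝ (Fin p) × EuclideanSpace ℝ (Fin m)), t) ∈ Z := ht
  -- As `l 0 t = 0`, zero deviation lands on the reference point, where `h` is `C^1` within the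
  -- slab.
  have he : ((0 : EuclideanSpace ℝ (Fin n)) + xs t,
      (0 : EuclideanSpace ℝ (Fin m)) + us t + l 0 t, t) = (xs t, us t, t) := by
    rw [hl0 t ht, zero_add, zero_add, add_zero]
  have hh' : ContDiffWithinAt ℝ 1
      (fun z : EuclideanSpace ℝ (Fin n) × EuclideanSpace ℝ (Fin m) × ℝ => h z.1 z.2.1 z.2.2)
      {z | z.2.2 ∈ Icc 0 T} ((0 : EuclideanSpace ℝ (Fin n)) + xs t,
        (0 : EuclideanSpace ℝ (Fin m)) + us t + l 0 t, t) := by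
    rw [he]
    refine (hh _ ⟨href t ht, ht⟩).mono_of_mem_nhdsWithin ?_
    exact inter_mem (mem_nhdsWithin_of_mem_nhds (hO.mem_nhds (href t ht))) self_mem_nhdsWithin
  exact ContDiffWithinAt.comp (g := fun z : EuclideanSpace ℝ (Fin n) ×
    EuclideanSpace ℝ (Fin m) × ℝ => h z.1 z.2.1 z.2.2) ((0 : EuclideanSpace ℝ (Fin n)),
      (0 : EuclideanSpace ℝ (Fin p) × EuclideanSpace ℝ (Fin m)), t) hh' (hφ _ hz) fun z hz => hz

theorem ilcProcess_stableLinearization (hT : 0 ≤ T)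
    (hus : ContDiffOn ℝ 1 us (Icc 0 T))
    (hxs : ContDiffOn ℝ 1 xs (Icc 0 T))
    (hydes : ∀ t ∈ Icc 0 T, ydes t = g (xs t) (us t) t)
    (hO : IsOpen O)
    (href : ∀ t ∈ Icc 0 T, (xs t, us t, t) ∈ O)
    (hf : ContDiffOn ℝ 1 (fun z => f z.1 z.2.1 z.2.2) (O ∩ {z | z.2.2 ∈ Icc 0 T}))
    (hg : ContDiffOn ℝ 1 (fun z => g z.1 z.2.1 z.2.2) (O ∩ {z | z.2.2 ∈ Icc 0 T}))
    (hl : ContDiffOn ℝ 1 (fun z : EuclideanSpace ℝ (Fin p) × ℝ => l z.1 z.2)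
      (univ ×ˢ Icc 0 T))
    (hl0 : ∀ t ∈ Icc 0 T, l 0 t = 0)
    (hrad : ∀ t ∈ Icc 0 T, matrixRadius
      (Matrix.fromRows (jacobianMatrix (fun v => g (xs t) v t) (us t))
          (1 : Matrix (Fin m) (Fin m) ℝ) *
        Matrix.fromCols (jacobianMatrix (fun θ => l θ t) 0)
          (1 : Matrix (Fin m) (Fin m) ℝ)) < 1) :
    (ilcProcess T f g l ydes xs us).StableLinearization where
  T_nonneg := hT
  f_zero t ht := by simp [ilcProcess, hl0 t ht]
  g_zero t ht := by simp [ilcProcess, hl0 t ht, hydes t ht]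
  contDiff_f t ht := by
    have ht2 : ContDiffOn ℝ 1 (fun z : EuclideanSpace ℝ (Fin n) ×
        (EuclideanSpace ℝ (Fin p) × EuclideanSpace ℝ (Fin m)) × ℝ => z.2.2)
        (DRP.passSlab _ _ T) := by fun_prop
    exact (contDiffWithinAt_deviation hus hxs hO href hf hl hl0 ht).sub
      (((contDiffOn_along_reference hus hxs href hf).comp ht2 fun z hz => hz) _ ht)
  contDiff_g t ht := by
    have ht2 : ContDiffOn ℝ 1 (fun z : EuclideanSpace ℝ (Fin n) ×
        (EuclideanSpace ℝ (Fin p) × EuclideanSpace ℝ (Fin m)) × ℝ => z.2.2)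
        (DRP.passSlab _ _ T) := by fun_prop
    have hy : ContDiffOn ℝ 1 ydes (Icc 0 T) :=
      (contDiffOn_along_reference hus hxs href hg).congr hydes
    have hl' : ContDiffOn ℝ 1 (fun z : EuclideanSpace ℝ (Fin n) ×
        (EuclideanSpace ℝ (Fin p) × EuclideanSpace ℝ (Fin m)) × ℝ => l z.2.1.1 z.2.2)
        (DRP.passSlab _ _ T) :=
      hl.comp (f := fun z : EuclideanSpace ℝ (Fin n) ×
        (EuclideanSpace ℝ (Fin p) × EuclideanSpace ℝ (Fin m)) × ℝ => (z.2.1.1, z.2.2))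
        (by fun_prop) fun z hz => ⟨mem_univ _, hz⟩
    have h2 : ContDiffOn ℝ 1 (fun z : EuclideanSpace ℝ (Fin n) ×
        (EuclideanSpace ℝ (Fin p) × EuclideanSpace ℝ (Fin m)) × ℝ => z.2.1.2)
        (DRP.passSlab _ _ T) := by fun_prop
    exact ((contDiffWithinAt_deviation hus hxs hO href hg hl hl0 ht).sub
      ((hy.comp ht2 fun z hz => hz) _ ht)).prodMk ((h2.add hl') _ ht)
  powerStable t ht := by
    -- At a fixed time the slab imposes no constraint on the input and `O` is open, so the
    -- derivative in the input is unrestricted.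
    have hgd : DifferentiableAt ℝ (fun v => g (xs t) v t) (us t) := by
      have h1 : ContDiffWithinAt ℝ 1 (fun v => g (xs t) v t) {v | (xs t, v, t) ∈ O} (us t) :=
        (hg _ ⟨href t ht, ht⟩).comp (us t) (f := fun v => (xs t, v, t)) (by fun_prop)
          fun v hv => ⟨hv, ht⟩
      have h2 : IsOpen {v | (xs t, v, t) ∈ O} := hO.preimage (by fun_prop)
      exact (h1.contDiffAt (h2.mem_nhds (href t ht))).differentiableAt (by simp)
    have hld : DifferentiableAt ℝ (fun θ => l θ t) 0 := by
      have h1 : ContDiffOn ℝ 1 (fun θ => l θ t) univ :=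
        hl.comp (f := fun θ => (θ, t)) (by fun_prop) fun v _ => ⟨mem_univ _, ht⟩
      exact ((contDiffOn_univ.1 h1).differentiable (by simp)) 0
    set D' := fderiv ℝ (fun v => g (xs t) v t) (us t) with hD'
    set L' := fderiv ℝ (fun θ => l θ t) 0 with hL'
    set C := ContinuousLinearMap.snd ℝ (EuclideanSpace ℝ (Fin p)) (EuclideanSpace ℝ (Fin m)) +
      L'.comp (ContinuousLinearMap.fst ℝ _ _) with hC
    refine ⟨(D'.prod (ContinuousLinearMap.id ℝ _)).comp C, ?_,
      tendsto_pow_of_matrixRadius_lt_one ((EuclideanSpace.basisFun (Fin p) ℝ).toBasis.prod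
        (EuclideanSpace.basisFun (Fin m) ℝ).toBasis) _ ?_⟩
    · have hc : HasFDerivAt (fun w : EuclideanSpace ℝ (Fin p) × EuclideanSpace ℝ (Fin m) =>
          w.2 + l w.1 t) C 0 :=
        hasFDerivAt_snd.add (HasFDerivAt.comp (0 : EuclideanSpace ℝ (Fin p) ×
          EuclideanSpace ℝ (Fin m)) (g := fun θ => l θ t) hld.hasFDerivAt hasFDerivAt_fst)
      have hG : HasFDerivAt (fun v => (g (xs t) (v + us t) t - ydes t, v))
          (D'.prod (ContinuousLinearMap.id ℝ _))
          ((0 : EuclideanSpace ℝ (Fin p) × EuclideanSpace ℝ (Fin m)).2 +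
            l (0 : EuclideanSpace ℝ (Fin p) × EuclideanSpace ℝ (Fin m)).1 t) := by
        have e : (0 : EuclideanSpace ℝ (Fin p) × EuclideanSpace ℝ (Fin m)).2 +
            l (0 : EuclideanSpace ℝ (Fin p) × EuclideanSpace ℝ (Fin m)).1 t = 0 := by
          simp [hl0 t ht]
        rw [e]
        have h1 : HasFDerivAt (fun v => g (xs t) (v + us t) t) D' 0 := by
          have h2 := hgd.hasFDerivAt
          rw [← zero_add (us t)] at h2
          simpa [hD'] using (hasFDerivAt_comp_add_right (us t)).2 h2
        exact (h1.sub_const _).prodMk (hasFDerivAt_id _)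
      have hcomp := hG.comp (0 : EuclideanSpace ℝ (Fin p) × EuclideanSpace ℝ (Fin m)) hc
      refine hcomp.congr_of_eventuallyEq (Eventually.of_forall fun w => ?_)
      simp only [ilcProcess, Function.comp, zero_add, add_right_comm]
    · rw [hC, toMatrix_comp_eq_fromRows_mul_fromCols, hD', hL',
        toMatrix_fderiv_eq_jacobianMatrix, toMatrix_fderiv_eq_jacobianMatrix]
      exact hrad t ht

/-- The second profile component encodes the update law; substituting it turns the remaining
equations into the plant equations of the next pass. A trajectory does not constrain `x 0`, so pass
0 is stated separately. -/
theorem isILCRun_iff_isTrajectory (hus : ContDiffOn ℝ 1 us (Icc 0 T))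
    (hxs : ∀ t ∈ Icc 0 T, HasDerivWithinAt xs (f (xs t) (us t) t) (Icc 0 T) t)
    (hydes : ContDiffOn ℝ 1 ydes (Icc 0 T)) (x : ℕ → ℝ → EuclideanSpace ℝ (Fin n))
    (u : ℕ → ℝ → EuclideanSpace ℝ (Fin m)) (y : ℕ → ℝ → EuclideanSpace ℝ (Fin p)) :
    IsILCRun T f g l ydes x u y ↔
      (∀ t ∈ Icc 0 T, HasDerivWithinAt (x 0) (f (x 0 t) (u 0 t) t) (Icc 0 T) t ∧
        y 0 t = g (x 0 t) (u 0 t) t) ∧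
      (ilcProcess T f g l ydes xs us).IsTrajectory
        (fun k t => x k t - xs t) (fun k t => (y k t - ydes t, u k t - us t)) := by
  constructor
  · intro h
    refine ⟨fun t ht => ⟨(h.2 0 t ht).1, (h.2 0 t ht).2.1⟩,
      fun k => ((h.1 k).2.sub hydes).prodMk ((h.1 k).1.sub hus), fun k t ht => ?_⟩
    obtain ⟨-, -, h3⟩ := h.2 k t ht
    obtain ⟨h1, h2, -⟩ := h.2 (k + 1) t ht
    have e : u k t - us t + us t + l (y k t - ydes t) t = u (k + 1) t := by
      rw [h3, sub_add_cancel]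
    refine ⟨?_, ?_⟩
    · simp only [ilcProcess, sub_add_cancel]
      rw [← h3]
      exact h1.sub (hxs t ht)
    · simp only [ilcProcess, sub_add_cancel]
      rw [← h3, ← h2, h3, sub_add_eq_add_sub]
  · rintro ⟨h0, hc, h⟩
    have hu : ∀ k, ∀ t ∈ Icc 0 T, u (k + 1) t = u k t + l (y k t - ydes t) t := by
      intro k t ht
      have h2 := congrArg Prod.snd (h k t ht).2
      simp only [ilcProcess, sub_add_eq_add_sub] at h2
      exact sub_left_injective h2
    refine ⟨fun k => ⟨?_, ?_⟩, fun k t ht => ?_⟩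
    · exact ((contDiff_snd.comp_contDiffOn (hc k)).add hus).congr fun t _ => by simp
    · exact ((contDiff_fst.comp_contDiffOn (hc k)).add hydes).congr fun t _ => by simp
    · rcases k with _ | k
      · exact ⟨(h0 t ht).1, (h0 t ht).2, hu 0 t ht⟩
      · obtain ⟨h1, h2⟩ := h k t ht
        simp only [ilcProcess, sub_add_cancel] at h1 h2
        rw [← hu k t ht] at h1 h2
        refine ⟨?_, ?_, hu (k + 1) t ht⟩
        · have h3 := h1.add (hxs t ht)
          rw [sub_add_cancel] at h3
          exact h3.congr_of_mem (fun s _ => by simp) ht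
        · exact sub_left_injective (congrArg Prod.fst h2)

end LearningControl

theorem mainTheorem8 {n m p : ℕ} (T : ℝ) (hT : 0 ≤ T)
    -- the plant and the update law
    (f : EuclideanSpace ℝ (Fin n) → EuclideanSpace ℝ (Fin m) → ℝ → EuclideanSpace ℝ (Fin n))
    (g : EuclideanSpace ℝ (Fin n) → EuclideanSpace ℝ (Fin m) → ℝ → EuclideanSpace ℝ (Fin p))
    (l : EuclideanSpace ℝ (Fin p) → ℝ → EuclideanSpace ℝ (Fin m))
    -- the achievable output with its reference state and input
    (xs : ℝ → EuclideanSpace ℝ (Fin n)) (us : ℝ → EuclideanSpace ℝ (Fin m))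
    (ydes : ℝ → EuclideanSpace ℝ (Fin p))
    (hus : ContDiffOn ℝ 1 us (Icc 0 T))
    (hxs : ∀ t ∈ Icc 0 T, HasDerivWithinAt xs (f (xs t) (us t) t) (Icc 0 T) t)
    (hydes : ∀ t ∈ Icc 0 T, ydes t = g (xs t) (us t) t)
    -- `f` and `g` are continuously differentiable near the reference trajectory
    (O : Set (EuclideanSpace ℝ (Fin n) × EuclideanSpace ℝ (Fin m) × ℝ)) (hO : IsOpen O)
    (href : ∀ t ∈ Icc 0 T, (xs t, us t, t) ∈ O)
    (hf : ContDiffOn ℝ 1 (fun z => f z.1 z.2.1 z.2.2) (O ∩ {z | z.2.2 ∈ Icc 0 T}))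
    (hg : ContDiffOn ℝ 1 (fun z => g z.1 z.2.1 z.2.2) (O ∩ {z | z.2.2 ∈ Icc 0 T}))
    (hl : ContDiffOn ℝ 1 (fun z : EuclideanSpace ℝ (Fin p) × ℝ => l z.1 z.2)
      (univ ×ˢ Icc 0 T))
    (hl0 : ∀ t ∈ Icc 0 T, l 0 t = 0)
    -- the linearized gains along the reference trajectory
    (D : ℝ → Matrix (Fin p) (Fin m) ℝ)
    (hD : ∀ t ∈ Icc 0 T, D t = jacobianMatrix (fun v => g (xs t) v t) (us t))
    (L : ℝ → Matrix (Fin m) (Fin p) ℝ)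
    (hL : ∀ t ∈ Icc 0 T, L t = jacobianMatrix (fun θ => l θ t) 0) :
    -- the learning scheme is the repetitive process `ilcProcess` in deviation coordinates
    (∀ (x : ℕ → ℝ → EuclideanSpace ℝ (Fin n)) (u : ℕ → ℝ → EuclideanSpace ℝ (Fin m))
        (y : ℕ → ℝ → EuclideanSpace ℝ (Fin p)),
      IsILCRun T f g l ydes x u y ↔
        (∀ t ∈ Icc 0 T, HasDerivWithinAt (x 0) (f (x 0 t) (u 0 t) t) (Icc 0 T) t ∧
          y 0 t = g (x 0 t) (u 0 t) t) ∧
        (ilcProcess T f g l ydes xs us).IsTrajectory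
          (fun k t => x k t - xs t) (fun k t => (y k t - ydes t, u k t - us t))) ∧
    -- the spectral condition in its equivalent forms
    (⨆ t ∈ Icc 0 T, matrixRadius
        (Matrix.fromRows (D t) (1 : Matrix (Fin m) (Fin m) ℝ) *
          Matrix.fromCols (L t) (1 : Matrix (Fin m) (Fin m) ℝ))) =
      (⨆ t ∈ Icc 0 T, matrixRadius (1 + L t * D t)) ∧
    (p = m → (⨆ t ∈ Icc 0 T, matrixRadius (1 + D t * L t)) =
      ⨆ t ∈ Icc 0 T, matrixRadius (1 + L t * D t)) ∧
    -- the stability claim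
    ((⨆ t ∈ Icc 0 T, matrixRadius (1 + L t * D t)) < 1 →
      (ilcProcess T f g l ydes xs us).ExponentiallyStable) := by
  have hxs' : ContDiffOn ℝ 1 xs (Icc 0 T) := contDiffOn_reference_state hus hxs href hf
  have hydes' : ContDiffOn ℝ 1 ydes (Icc 0 T) :=
    (contDiffOn_along_reference hus hxs' href hg).congr hydes
  have hrad : ∀ t, matrixRadius
      (Matrix.fromRows (D t) (1 : Matrix (Fin m) (Fin m) ℝ) *
        Matrix.fromCols (L t) (1 : Matrix (Fin m) (Fin m) ℝ)) = matrixRadius (1 + L t * D t) := by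
    intro t
    -- Swapping the block factors leaves `[L I][D; I] = L * D + 1`.
    rw [matrixRadius_mul_comm, Matrix.fromCols_mul_fromRows, Matrix.one_mul, add_comm]
  refine ⟨isILCRun_iff_isTrajectory hus hxs hydes', ?_, ?_, fun h => ?_⟩
  · simp only [hrad]
  · rintro rfl
    simp only [matrixRadius_one_add_mul_comm (D _) (L _)]
  · refine (ilcProcess_stableLinearization hT hus hxs' hydes hO href hf hg hl hl0
      fun t ht => ?_).exponentiallyStable
    rw [← hD t ht, ← hL t ht, hrad]
    exact (le_iSup₂ (f := fun t (_ : t ∈ Icc 0 T) => matrixRadius (1 + L t * D t)) t ht).trans_lt h
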